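/- Let $\mathbb{D}^d$ be the open unit polydisk and $\mathbb{T}^d$ the $d$-torus. A rational inner function (RIF) on $\mathbb{D}^d$ is a bounded function $\phi=q/p$ with $q,p\in\mathbb{C}[z_1,\dots,z_d]$, $p$ zero-free in $\mathbb{D}^d$, whose non-tangential boundary values are unimodular almost everywhere on $\mathbb{T}^d$. When $q$ and $p$ have no common factor, the singularities of $\phi$ are the zeros of $p$ on $\mathbb{T}^d$, and the degree of $\phi$ in $z_j$ is $\max(\deg_{z_j}q,\deg_{z_j}p)$. The local $z_d$-derivative integrability index of $\phi$ at $\zeta\in\mathbb{T}^d$ is the supremum of the exponents $\mathfrak{p}\ge 1$ such that the boundary function of $\partial\phi/\partial z_d$ is in $L^{\mathfrak p}$ of a neighborhood of $\zeta$ in $\mathbb{T}^d$. For $d\ge 2$ let $$\phi_d(z)=\frac{d\prod_{k=1}^d z_k-\sum_{j=1}^d\prod_{k\ne j}z_k}{d-\sum_{k=1}^d z_k},$$ and for $N\ge 1$ let $\phi_d^N(\hat z,z_d)$ be the value at $z_d$ of the $N$-fold composition of the one-variable function $\phi_d(\hat z,\cdot)$ with itself, where $\hat z=(z_1,\dots,z_{d-1})$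 is fixed. 1. For all $d\ge 2$ and $N\ge 1$, $\phi_d^N$ is a RIF of degree $1$ in $z_d$, and its only singularity is $(1,\dots,1)$. For every real $\mathfrak{p}\ge 1$, $$\frac{\partial \phi_d^N}{\partial z_d}\in L^{\mathfrak p}(\mathbb{T}^d)\quad\Longleftrightarrow\quad \mathfrak p<\mathfrak p^*(d,N):=1+\frac{d-1}{2N},$$ and $\mathfrak p^*(d,N)$ is the local $z_d$-derivative integrability index of $\phi_d^N$ at $(1,\dots,1)$. 2. In particular, $\phi_3^2$ has tridegree $(2,2,1)$, denominator (in lowest terms) $$9-6z_1-6z_2-3z_3+z_1^2+z_2^2+3z_1z_2+2z_1z_3+2z_2z_3-3z_1z_2z_3,$$ a single singularity, at $(1,1,1)$, and local $z_3$-derivative integrability index $3/2$ there, whereas the index of $\phi_3$ at $(1,1,1)$ is $2$. Hence there is a three-variable RIF of tridegree $(n_1,n_2,1)$ with a single isolated singularity and worse derivative integrability than $\phi_3$. 3. For every $K\ge 1$, $\phi_2^K$ is a RIF whose only singularity is $(1,1)$, and it has $z_2$-contact order $2K$ there: for $\theta$ near $0$ the numerator of $\phi_2^K$ (in lowest terms)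 has exactly one zero $\psi(\theta)$ as a polynomial in $z_2$ on the line $z_1=e^{i\theta}$, and $1-|\psi(\theta)|^2\asymp\theta^{2K}$. Thus every positive even integer is the contact order of a RIF on $\mathbb{D}^2$ with a unique singularity. -/

import Mathlib

open MeasureTheory Filter Topology

noncomputable section

/-- The open unit polydisk in `ℂ^d`. -/
def polydisk (d : ℕ) : Set (Fin d → ℂ) := {z | ∀ j, ‖z j‖ < 1}

/-- The `d`-torus, the distinguished boundary of the polydisk. -/
def torus (d : ℕ) : Set (Fin d → ℂ) := {ζ | ∀ j, ‖ζ j‖ = 1}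

/-- The point `(exp (i θ₁), …, exp (i θ_d))` of the torus. -/
def expPoint {d : ℕ} (θ : Fin d → ℝ) : Fin d → ℂ := fun j => Complex.exp (θ j * Complex.I)

/-- Product arc-length measure on the torus, as a measure on `ℂ^d`: the image of Lebesgue measure
on `(-π, π]^d` under `expPoint`. -/
def torusMeasure (d : ℕ) : Measure (Fin d → ℂ) :=
  (volume.restrict (Set.univ.pi fun _ : Fin d => Set.Ioc (-Real.pi) Real.pi)).map expPoint

/-- The non-tangential approach region with aperture `α` at a point `ζ` of the torus. -/
def approachRegion {d : ℕ} (α : ℝ) (ζ : Fin d → ℂ) : Set (Fin d → ℂ) :=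
  {z | z ∈ polydisk d ∧ ∀ j, ‖z j - ζ j‖ < α * (1 - ‖z j‖)}

/-- `f`, a function on the polydisk, has the non-tangential limit `c` at the torus point `ζ`. -/
def HasNTLimit {d : ℕ} (f : (Fin d → ℂ) → ℂ) (ζ : Fin d → ℂ) (c : ℂ) : Prop :=
  ∀ α : ℝ, 1 < α → Tendsto f (𝓝[approachRegion α ζ] ζ) (𝓝 c)

/-- `q / p` represents `φ` on the polydisk, and `p` has no zeros there. -/
def IsRationalForm {d : ℕ} (φ : (Fin d → ℂ) → ℂ) (q p : MvPolynomial (Fin d) ℂ) : Prop :=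
  ∀ z ∈ polydisk d, p.eval z ≠ 0 ∧ φ z = q.eval z / p.eval z

/-- `q / p` represents `φ` on the polydisk, `p` has no zeros there, and all common factors of `q`
and `p` have been cancelled. -/
def IsReducedForm {d : ℕ} (φ : (Fin d → ℂ) → ℂ) (q p : MvPolynomial (Fin d) ℂ) : Prop :=
  IsRationalForm φ q p ∧ IsRelPrime q p

/-- Rational inner functions on the polydisk: bounded functions `q / p` with `p` zero-free in the
polydisk (hence holomorphic there), whose non-tangential boundary values are unimodular almost
everywhere on the torus. -/
structure IsRationalInner {d : ℕ} (φ : (Fin d → ℂ) → ℂ) : Prop where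
  rational : ∃ q p : MvPolynomial (Fin d) ℂ, IsRationalForm φ q p
  bounded : ∃ C : ℝ, ∀ z ∈ polydisk d, ‖φ z‖ ≤ C
  inner : ∀ᵐ ζ ∂(torusMeasure d), ∃ c : ℂ, HasNTLimit φ ζ c ∧ ‖c‖ = 1

/-- `φ` has degree `k` in the variable `z_j`: this is the larger of the `z_j`-degrees of numerator
and denominator, after cancellation of common factors. -/
def HasDegreeIn {d : ℕ} (φ : (Fin d → ℂ) → ℂ) (j : Fin d) (k : ℕ) : Prop :=
  ∃ q p : MvPolynomial (Fin d) ℂ,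
    IsReducedForm φ q p ∧ max (q.degreeOf j) (p.degreeOf j) = k

/-- The singularities of `φ` on the torus: the zeros there of the denominator that remains after
cancellation of common factors. -/
def singularSet {d : ℕ} (φ : (Fin d → ℂ) → ℂ) : Set (Fin d → ℂ) :=
  {ζ | ζ ∈ torus d ∧ ∃ q p : MvPolynomial (Fin d) ℂ, IsReducedForm φ q p ∧ p.eval ζ = 0}

/-- The derivative `∂f/∂z_d` with respect to the last variable; here `d = n + 1`. -/
def lastDeriv {n : ℕ} (f : (Fin (n + 1) → ℂ) → ℂ) (z : Fin (n + 1) → ℂ) : ℂ :=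
  deriv (fun w => f (Function.update z (Fin.last n) w)) (z (Fin.last n))

/-- The boundary function of `f` (given by its non-tangential limits, which exist almost everywhere)
belongs to `L^s` of the part of the torus that lies in `U`. -/
def BoundaryMemLp {d : ℕ} (f : (Fin d → ℂ) → ℂ) (s : ℝ) (U : Set (Fin d → ℂ)) : Prop :=
  ∃ g : (Fin d → ℂ) → ℂ,
    (∀ᵐ ζ ∂((torusMeasure d).restrict U), HasNTLimit f ζ (g ζ)) ∧
      MemLp g (ENNReal.ofReal s) ((torusMeasure d).restrict U)

/-- `s` is the local `z_d`-derivative integrability index (cutoff) of `φ` at the torus point `ζ`: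
the supremum of the exponents `r ≥ 1` for which `∂φ/∂z_d` is `L^r` on a neighborhood of `ζ`
in the torus. -/
def IsLocalDerivIndex {n : ℕ} (φ : (Fin (n + 1) → ℂ) → ℂ) (ζ : Fin (n + 1) → ℂ) (s : ℝ) : Prop :=
  IsLUB {r : ℝ | 1 ≤ r ∧ ∃ U ∈ 𝓝 ζ, BoundaryMemLp (lastDeriv φ) r U} s

/-- The composition `φ^N` in the last variable: with `ẑ = (z₁, …, z_{d-1})` kept fixed, the
one-variable function `φ_ẑ = φ(ẑ, ·)` is composed with itself `N` times and evaluated at `z_d`. -/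
def compPow {n : ℕ} (φ : (Fin (n + 1) → ℂ) → ℂ) (N : ℕ) (z : Fin (n + 1) → ℂ) : ℂ :=
  (fun w => φ (Function.update z (Fin.last n) w))^[N] (z (Fin.last n))

/-- The standard example `φ_d`: the numerator is `d z₁ ⋯ z_d` minus the sum of all products of `d-1`
distinct variables, the denominator is `d - (z₁ + ⋯ + z_d)`. -/
def stdRIF (d : ℕ) (z : Fin d → ℂ) : ℂ :=
  (d * ∏ k, z k - ∑ j, ∏ k ∈ Finset.univ.erase j, z k) / (d - ∑ k, z k)

/-- The number `1 + (d - 1) / (2 N)`. -/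
def cutoff (d N : ℕ) : ℝ := 1 + ((d : ℝ) - 1) / (2 * N)

/-- A function `φ` of two variables with degree one in `z₂` and a singularity at
`(exp (i η₁), exp (i η₂))` has `z₂`-contact order `k` there: `1 - |ψ(θ)|²` is comparable to
`(θ - η₁)^k` for `θ` near `η₁`, where `ψ(θ)` denotes the (unique) zero of the numerator of `φ` on
the line `z₁ = exp (i θ)`. -/
def HasContactOrder (φ : (Fin 2 → ℂ) → ℂ) (η₁ η₂ : ℝ) (k : ℕ) : Prop :=
  HasDegreeIn φ 1 1 ∧ expPoint ![η₁, η₂] ∈ singularSet φ ∧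
    ∃ q p : MvPolynomial (Fin 2) ℂ, IsReducedForm φ q p ∧
      ∃ ψ : ℝ → ℂ,
        (∀ᶠ θ : ℝ in 𝓝 η₁, ∀ w : ℂ, q.eval ![Complex.exp ((θ : ℂ) * Complex.I), w] = 0 ↔ w = ψ θ) ∧
          Asymptotics.IsTheta (𝓝 η₁) (fun θ : ℝ => 1 - ‖ψ θ‖ ^ 2)
            (fun θ : ℝ => (θ - η₁) ^ k)

open MvPolynomial in
/-- The denominator of the second composition of `φ_3`. -/
def denomThreeTwo : MvPolynomial (Fin 3) ℂ :=
  9 - 6 * X 0 - 6 * X 1 - 3 * X 2 + X 0 ^ 2 + X 1 ^ 2 + 3 * X 0 * X 1 + 2 * X 0 * X 2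
    + 2 * X 1 * X 2 - 3 * X 0 * X 1 * X 2

end

/-! Fix ẑ and put a = d - (z₁ + ⋯ + z_{d-1}), P = z₁ ⋯ z_{d-1}. Then φ_d(ẑ, ·) is the Möbius map
with matrix M = [[ã, -P], [-1, a]], and φ_d^N has matrix M^N = [[A, -PC], [-C, D]]. This shape
persists because M^N is a combination of M and the identity (`mobPow_sub`); the determinant is (aã -
P)^N (`mobPow_det`).

On the torus ã = P ā, and this symmetry passes to powers: A = P^N D̄ and PC = P^N C̄. The
determinant identity becomes |D|² - |C|² = (|a|² - 1)^N (`norm_sq_sub_norm_sq`). Hence |∂φ_d^N/∂z_d|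
= (|D|² - |C|²) / |D - C z_d|² is a Poisson kernel in z_d (`norm_derivPow_expPoint`). If v denotes
the angles of ẑ, then |a|² - 1 ≍ |v|², so Δ = |D|² - |C|² ≍ |v|^{2N}. A Poisson kernel of mass 2π
and height about 1/Δ has r-th power integral of order Δ^{1-r}, here |v|^{-2N(r-1)} near v = 0.
Integrating over v in ℝ^{d-1} gives a finite value exactly when 2N(r-1) < d-1.

The denominators satisfy den_{N+1} = a den_N - num_N. Since |num_N| ≤ |den_N| by the maximum
principle and |a| > 1 unless ẑ = 1, they vanish on the closed polydisk at most at (1, …, 1). That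
singularity survives cancellation (`eval_one_eq_zero_of_cross_mul`): otherwise the zero set of the
numerator would meet torus values ẑ ≠ 1 where the determinant is zero.

For d = 2 the zero of the numerator is ψ = PC/A, and 1 - |ψ|² = (|a|² - 1)^K / |D|² ≍ θ^{2K}. For
lowest terms, a common prime factor divides the determinant, which is free of z_d
(`dvd_rename_mobDet`); this leaves few candidates. -/

/-- With `ẑ` fixed, `φ_d` is the Möbius map `w ↦ (ã w - P) / (a - w)`; this is `a`. -/
noncomputable def mobA (n : ℕ) : MvPolynomial (Fin n) ℂ :=
  MvPolynomial.C ((n : ℂ) + 1) - ∑ k, MvPolynomial.X k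

/-- The product `P` of the first variables. -/
noncomputable def mobP (n : ℕ) : MvPolynomial (Fin n) ℂ := ∏ k, MvPolynomial.X k

/-- The reflection `ã` of `mobA`. -/
noncomputable def mobR (n : ℕ) : MvPolynomial (Fin n) ℂ :=
  MvPolynomial.C ((n : ℂ) + 1) * mobP n - ∑ j, ∏ k ∈ Finset.univ.erase j, MvPolynomial.X k

/-- The polynomials `(A, C, D)` for which the `N`-th composition of the Möbius map
is `w ↦ (A w - P C) / (D - C w)`. -/
noncomputable def mobPow (n : ℕ) : ℕ →
    MvPolynomial (Fin n) ℂ × MvPolynomial (Fin n) ℂ × MvPolynomial (Fin n) ℂ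
  | 0 => (1, 0, 1)
  | N + 1 => (mobR n * (mobPow n N).1 + mobP n * (mobPow n N).2.1,
      mobA n * (mobPow n N).2.1 + (mobPow n N).1,
      mobA n * (mobPow n N).2.2 + mobP n * (mobPow n N).2.1)

/-- The determinant of the Möbius map. -/
noncomputable def mobDet (n : ℕ) : MvPolynomial (Fin n) ℂ := mobA n * mobR n - mobP n

/-! ### Powers of the Möbius matrix -/

section algebra

variable (n N : ℕ)

/-- M^N = C M + s I for some scalar s, so the difference of its diagonal entries is C times that of
M. The recursion defines only three entries of M · M^N; this identity is what makes the upper right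
entry equal to -P times the new C. -/
lemma mobPow_sub : (mobPow n N).2.2 - (mobPow n N).1 =
    (mobA n - mobR n) * (mobPow n N).2.1 := by
  induction N with
  | zero => simp [mobPow]
  | succ N ih =>
    simp only [mobPow]
    linear_combination (mobA n) * ih

lemma mobPow_det : (mobPow n N).1 * (mobPow n N).2.2 - mobP n * (mobPow n N).2.1 ^ 2 =
    mobDet n ^ N := by
  induction N with
  | zero => simp [mobPow]
  | succ N ih =>
    have h := mobPow_sub n N
    rw [pow_succ (mobDet n), ← ih]
    simp only [mobPow, mobDet]
    linear_combination (mobP n * ((mobPow n N).1 + mobA n * (mobPow n N).2.1)) * h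

/-- Numerator of the `N`-th composition. -/
noncomputable def numPow : MvPolynomial (Fin (n + 1)) ℂ :=
  MvPolynomial.rename Fin.castSucc (mobPow n N).1 * MvPolynomial.X (Fin.last n) -
    MvPolynomial.rename Fin.castSucc (mobP n * (mobPow n N).2.1)

/-- Denominator of the `N`-th composition. -/
noncomputable def denPow : MvPolynomial (Fin (n + 1)) ℂ :=
  MvPolynomial.rename Fin.castSucc (mobPow n N).2.2 -
    MvPolynomial.rename Fin.castSucc (mobPow n N).2.1 * MvPolynomial.X (Fin.last n)

end algebra

section eval

variable {n : ℕ} (N : ℕ)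

lemma eval_mobA (v : Fin n → ℂ) : (mobA n).eval v = n + 1 - ∑ k, v k := by
  simp [mobA]

lemma eval_mobP (v : Fin n → ℂ) : (mobP n).eval v = ∏ k, v k := by
  simp [mobP]

lemma eval_mobR (v : Fin n → ℂ) : (mobR n).eval v =
    (n + 1) * ∏ k, v k - ∑ j, ∏ k ∈ Finset.univ.erase j, v k := by
  simp [mobR, eval_mobP]

lemma eval_numPow (z : Fin (n + 1) → ℂ) : (numPow n N).eval z =
    (mobPow n N).1.eval (Fin.init z) * z (Fin.last n) -
      (mobP n).eval (Fin.init z) * (mobPow n N).2.1.eval (Fin.init z) := by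
  simp only [numPow, map_sub, map_mul, MvPolynomial.eval_rename, MvPolynomial.eval_X]
  rfl

lemma eval_denPow (z : Fin (n + 1) → ℂ) : (denPow n N).eval z =
    (mobPow n N).2.2.eval (Fin.init z) -
      (mobPow n N).2.1.eval (Fin.init z) * z (Fin.last n) := by
  simp only [denPow, map_sub, map_mul, MvPolynomial.eval_rename, MvPolynomial.eval_X]
  rfl

lemma eval_numPow_succ (z : Fin (n + 1) → ℂ) : (numPow n (N + 1)).eval z =
    (mobR n).eval (Fin.init z) * (numPow n N).eval z -
      (mobP n).eval (Fin.init z) * (denPow n N).eval z := by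
  have h := congrArg (MvPolynomial.eval (Fin.init z)) (mobPow_sub n N)
  simp only [map_sub, map_mul] at h
  simp only [eval_numPow, eval_denPow, mobPow, map_add, map_mul]
  linear_combination (mobP n).eval (Fin.init z) * h

lemma eval_denPow_succ (z : Fin (n + 1) → ℂ) : (denPow n (N + 1)).eval z =
    (mobA n).eval (Fin.init z) * (denPow n N).eval z - (numPow n N).eval z := by
  simp only [eval_numPow, eval_denPow, mobPow, map_add, map_mul]
  ring

lemma eval_mobPow_det (v : Fin n → ℂ) : (mobPow n N).1.eval v * (mobPow n N).2.2.eval v -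
    (mobP n).eval v * (mobPow n N).2.1.eval v ^ 2 = (mobDet n).eval v ^ N := by
  have h := congrArg (MvPolynomial.eval v) (mobPow_det n N)
  simpa only [map_sub, map_mul, map_pow] using h

/-- The value of `φ_d` in terms of the coefficients of its Möbius map. -/
lemma stdRIF_eq (z : Fin (n + 1) → ℂ) : stdRIF (n + 1) z =
    ((mobR n).eval (Fin.init z) * z (Fin.last n) - (mobP n).eval (Fin.init z)) /
      ((mobA n).eval (Fin.init z) - z (Fin.last n)) := by
  have herase : ∀ j : Fin n, ∏ k ∈ Finset.univ.erase j.castSucc, z k =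
      (∏ k ∈ Finset.univ.erase j, Fin.init z k) * z (Fin.last n) := by
    intro j
    rw [← Finset.sdiff_singleton_eq_erase, ← Finset.sdiff_singleton_eq_erase]
    have : (Finset.univ \ {j.castSucc} : Finset (Fin (n + 1))) =
        insert (Fin.last n) ((Finset.univ \ {j}).map Fin.castSuccEmb) := by
      ext k
      refine Fin.lastCases ?_ (fun i => ?_) k
      · simp [(Fin.castSucc_lt_last j).ne']
      · simp [Fin.castSucc_inj, (Fin.castSucc_lt_last i).ne]
    rw [this, Finset.prod_insert (by simp [Fin.castSucc_ne_last]), Finset.prod_map, mul_comm]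
    rfl
  have hlast : ∏ k ∈ Finset.univ.erase (Fin.last n), z k = ∏ k, Fin.init z k := by
    have : (Finset.univ.erase (Fin.last n)) = Finset.univ.map Fin.castSuccEmb := by
      ext k
      refine Fin.lastCases ?_ (fun i => ?_) k
      · simp [Fin.castSucc_ne_last]
      · simp [(Fin.castSucc_lt_last i).ne]
    rw [this, Finset.prod_map]
    rfl
  rw [stdRIF, eval_mobA, eval_mobP, eval_mobR, Fin.prod_univ_castSucc, Fin.sum_univ_castSucc,
    Fin.sum_univ_castSucc, hlast]
  simp only [herase, ← Finset.sum_mul, Fin.init]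
  push_cast
  congr 1 <;> ring

lemma init_update_last (z : Fin (n + 1) → ℂ) (w : ℂ) :
    Fin.init (Function.update z (Fin.last n) w) = Fin.init z := by
  simp [Fin.init_update_last]

/-- Wherever the intermediate denominators do not vanish, `φ^N` is the quotient of
`numPow` and `denPow`. -/
lemma compPow_stdRIF_eq (z : Fin (n + 1) → ℂ) (h : ∀ k ≤ N, (denPow n k).eval z ≠ 0) :
    compPow (stdRIF (n + 1)) N z = (numPow n N).eval z / (denPow n N).eval z := by
  induction N with
  | zero => simp [compPow, eval_numPow, eval_denPow, mobPow]
  | succ N ih =>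
    have hN := h N (Nat.le_succ N)
    have hN' := h (N + 1) le_rfl
    specialize ih fun k hk => h k (hk.trans (Nat.le_succ N))
    rw [compPow] at ih ⊢
    rw [Function.iterate_succ_apply', ih, stdRIF_eq, init_update_last, Function.update_self,
      eval_numPow_succ, eval_denPow_succ]
    rw [eval_denPow_succ] at hN'
    have h2 : (mobA n).eval (Fin.init z) - (numPow n N).eval z / (denPow n N).eval z ≠ 0 := by
      intro h0
      apply hN'
      field_simp at h0
      linear_combination h0
    rw [div_eq_div_iff h2 hN']
    field_simp

end eval

/-! ### Reflection symmetry on the torus -/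

section torus

variable {n : ℕ} (N : ℕ) {v : Fin n → ℂ}

lemma mul_conj_eq_one {w : ℂ} (h : ‖w‖ = 1) : w * (starRingEnd ℂ) w = 1 := by
  rw [Complex.mul_conj, Complex.normSq_eq_norm_sq, h]; simp

lemma norm_eval_mobP (hv : v ∈ torus n) : ‖(mobP n).eval v‖ = 1 := by
  rw [eval_mobP, norm_prod]
  exact Finset.prod_eq_one fun j _ => hv j

lemma prod_erase_eq {ι : Type*} [Fintype ι] [DecidableEq ι] {z : ι → ℂ} (hz : ∀ j, ‖z j‖ = 1)
    (j : ι) : ∏ k ∈ Finset.univ.erase j, z k = (∏ k, z k) * (starRingEnd ℂ) (z j) := by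
  rw [← Finset.mul_prod_erase _ _ (Finset.mem_univ j)]
  linear_combination (-∏ k ∈ Finset.univ.erase j, z k) * mul_conj_eq_one (hz j)

lemma eval_mobR_torus (hv : v ∈ torus n) :
    (mobR n).eval v = (mobP n).eval v * (starRingEnd ℂ) ((mobA n).eval v) := by
  rw [eval_mobR, eval_mobP, eval_mobA]
  simp only [prod_erase_eq hv, map_sub, map_add, map_natCast, map_one, map_sum, mul_sub,
    Finset.mul_sum]
  ring

/-- The relation ã = P ā says that M is fixed, up to the factor P, by conjugating its entries and
exchanging its rows and columns; its powers inherit this. The difference identity `mobPow_sub`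
closes the induction for C. -/
lemma conj_mobPow_torus (hv : v ∈ torus n) :
    (mobPow n N).1.eval v = (mobP n).eval v ^ N * (starRingEnd ℂ) ((mobPow n N).2.2.eval v) ∧
    (mobP n).eval v * (mobPow n N).2.1.eval v =
      (mobP n).eval v ^ N * (starRingEnd ℂ) ((mobPow n N).2.1.eval v) := by
  induction N with
  | zero => simp [mobPow]
  | succ N ih =>
    have h := congrArg (MvPolynomial.eval v) (mobPow_sub n N)
    simp only [map_sub, map_mul] at h
    have hP := mul_conj_eq_one (norm_eval_mobP hv)
    have hP' : ∀ N, (mobP n).eval v ^ N * (starRingEnd ℂ) ((mobP n).eval v) ^ N = 1 := by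
      intro N; rw [← mul_pow, hP, one_pow]
    obtain ⟨h1, h2⟩ := ih
    have h1' := congrArg (starRingEnd ℂ) h1
    simp only [map_mul, map_pow, Complex.conj_conj] at h1'
    have h3 : (mobP n).eval v ^ N * (starRingEnd ℂ) ((mobPow n N).1.eval v) =
        (mobPow n N).2.2.eval v := by
      rw [h1']; linear_combination (mobPow n N).2.2.eval v * hP' N
    have hR := eval_mobR_torus hv
    simp only [mobPow, map_add, map_mul]
    constructor
    · rw [hR, h1]
      linear_combination (-(mobP n).eval v ^ N * (starRingEnd ℂ) ((mobPow n N).2.1.eval v)) * hP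
        + h2
    · rw [hR] at h
      rw [pow_succ]
      linear_combination (-(mobP n).eval v) * h - (mobP n).eval v * h3
        + (mobP n).eval v * (starRingEnd ℂ) ((mobA n).eval v) * h2

lemma eval_mobDet_torus (hv : v ∈ torus n) : (mobDet n).eval v =
    (mobP n).eval v * ((‖(mobA n).eval v‖ ^ 2 - 1 : ℝ) : ℂ) := by
  have := Complex.mul_conj ((mobA n).eval v)
  rw [Complex.normSq_eq_norm_sq] at this
  rw [mobDet, map_sub, map_mul, eval_mobR_torus hv]
  push_cast at this ⊢
  linear_combination (mobP n).eval v * this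

/-- The determinant identity AD - PC² = (aã - P)^N with the torus symmetry inserted; the unimodular
factor P^N cancels from both sides. -/
lemma norm_sq_sub_norm_sq (hv : v ∈ torus n) :
    ‖(mobPow n N).2.2.eval v‖ ^ 2 - ‖(mobPow n N).2.1.eval v‖ ^ 2 =
      (‖(mobA n).eval v‖ ^ 2 - 1) ^ N := by
  have h := eval_mobPow_det N v
  obtain ⟨h1, h2⟩ := conj_mobPow_torus N hv
  have hP : (mobP n).eval v ^ N ≠ 0 := by
    apply pow_ne_zero
    intro h0
    simpa [h0] using norm_eval_mobP hv
  have hC := Complex.mul_conj ((mobPow n N).2.1.eval v)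
  have hD := Complex.mul_conj ((mobPow n N).2.2.eval v)
  rw [Complex.normSq_eq_norm_sq] at hC hD
  rw [eval_mobDet_torus hv, mul_pow, h1] at h
  have : ((‖(mobPow n N).2.2.eval v‖ ^ 2 - ‖(mobPow n N).2.1.eval v‖ ^ 2 : ℝ) : ℂ) =
      (((‖(mobA n).eval v‖ ^ 2 - 1) ^ N : ℝ) : ℂ) := by
    apply mul_left_cancel₀ hP
    push_cast at hC hD h ⊢
    rw [← h, ← hC, ← hD]
    linear_combination (mobPow n N).2.1.eval v * h2
  exact_mod_cast this

lemma norm_mobPow_fst (hv : v ∈ torus n) :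
    ‖(mobPow n N).1.eval v‖ = ‖(mobPow n N).2.2.eval v‖ := by
  rw [(conj_mobPow_torus N hv).1]
  simp [norm_eval_mobP hv]

lemma norm_eval_numPow_torus {z : Fin (n + 1) → ℂ} (hz : z ∈ torus (n + 1)) :
    ‖(numPow n N).eval z‖ = ‖(denPow n N).eval z‖ := by
  have hv : Fin.init z ∈ torus n := fun j => hz _
  obtain ⟨h1, h2⟩ := conj_mobPow_torus N hv
  have hw := mul_conj_eq_one (hz (Fin.last n))
  have : (numPow n N).eval z = (mobP n).eval (Fin.init z) ^ N * z (Fin.last n) *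
      (starRingEnd ℂ) ((denPow n N).eval z) := by
    rw [eval_numPow, eval_denPow, h1, h2]
    simp only [map_sub, map_mul]
    linear_combination ((mobP n).eval (Fin.init z) ^ N *
      (starRingEnd ℂ) ((mobPow n N).2.1.eval (Fin.init z))) * hw
  rw [this]
  simp [norm_eval_mobP hv, hz (Fin.last n)]

end torus

section one

variable (n N : ℕ)

lemma eval_mobA_one : (mobA n).eval 1 = 1 := by simp [eval_mobA]

lemma eval_mobP_one : (mobP n).eval 1 = 1 := by simp [eval_mobP]

lemma eval_mobR_one : (mobR n).eval 1 = 1 := by simp [eval_mobR]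

lemma eval_mobPow_one : (mobPow n (N + 1)).1.eval 1 = 2 ^ N ∧
    (mobPow n (N + 1)).2.1.eval 1 = 2 ^ N ∧ (mobPow n (N + 1)).2.2.eval 1 = 2 ^ N := by
  induction N with
  | zero => simp [mobPow, eval_mobA_one, eval_mobR_one]
  | succ N ih =>
    rw [mobPow]
    obtain ⟨h1, h2, h3⟩ := ih
    simp only [map_add, map_mul, h1, h2, h3, eval_mobA_one, eval_mobP_one, eval_mobR_one, pow_succ]
    refine ⟨?_, ?_, ?_⟩ <;> ring

end one

/-! ### Maximum principle and zeros of the denominators -/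

section maximum

variable {ι : Type*}

lemma differentiable_update [DecidableEq ι] (z : ι → ℂ) (j k : ι) :
    Differentiable ℂ fun w : ℂ => Function.update z j w k := by
  rcases eq_or_ne k j with rfl | h
  · simp
  · simp [Function.update_of_ne h]

variable [Fintype ι]

lemma norm_sum_le_card {z : ι → ℂ} (hz : ∀ j, ‖z j‖ ≤ 1) : ‖∑ j, z j‖ ≤ Fintype.card ι :=
  (norm_sum_le _ _).trans <| (Finset.sum_le_sum fun j _ => hz j).trans (by simp)

lemma sub_sum_ne_zero {c : ℝ} (hc : Fintype.card ι < c) {z : ι → ℂ} (hz : ∀ j, ‖z j‖ ≤ 1) :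
    (c : ℂ) - ∑ j, z j ≠ 0 := by
  intro h
  have h1 := norm_sum_le_card hz
  rw [← sub_eq_zero.1 h, Complex.norm_real, Real.norm_eq_abs] at h1
  linarith [le_abs_self c]

/-- The maximum principle, one variable at a time, for the standard rational inner function with
denominator `c - ∑ z_j`, `c` larger than the number of variables. -/
lemma norm_std_quotient_le_one [DecidableEq ι] {c : ℝ} (hc : Fintype.card ι < c) (S : Finset ι) :
    ∀ z : ι → ℂ, (∀ j, ‖z j‖ ≤ 1) → (∀ j ∉ S, ‖z j‖ = 1) →
      ‖(c * ∏ k, z k - ∑ j, ∏ k ∈ Finset.univ.erase j, z k) / (c - ∑ k, z k)‖ ≤ 1 := by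
  induction S using Finset.induction_on with
  | empty =>
    intro z hz hz1
    have hz1 : ∀ j, ‖z j‖ = 1 := fun j => hz1 j (Finset.notMem_empty j)
    have : c * ∏ k, z k - ∑ j, ∏ k ∈ Finset.univ.erase j, z k =
        (∏ k, z k) * (starRingEnd ℂ) (c - ∑ k, z k) := by
      simp only [prod_erase_eq hz1, map_sub, map_sum, Complex.conj_ofReal, mul_sub, Finset.mul_sum]
      ring
    rw [this, norm_div, norm_mul, norm_prod, Finset.prod_eq_one fun j _ => hz1 j, one_mul,
      RCLike.norm_conj]
    exact div_self_le_one _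
  | insert i S hi ih =>
    intro z hz hz1
    have hupd : ∀ w : ℂ, ‖w‖ ≤ 1 → ∀ j, ‖Function.update z i w j‖ ≤ 1 := by
      intro w hw j
      rcases eq_or_ne j i with rfl | h
      · simpa using hw
      · simpa [Function.update_of_ne h] using hz j
    have hd : DiffContOnCl ℂ (fun w : ℂ => (c * ∏ k, Function.update z i w k -
        ∑ j, ∏ k ∈ Finset.univ.erase j, Function.update z i w k) /
          (c - ∑ k, Function.update z i w k)) (Metric.ball 0 1) := by
      apply DifferentiableOn.diffContOnCl
      rw [closure_ball _ one_ne_zero]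
      have hk := differentiable_update z i
      have hp : ∀ s : Finset ι, Differentiable ℂ
          fun w : ℂ => ∏ k ∈ s, Function.update z i w k := fun s =>
        Differentiable.fun_finsetProd fun k _ => hk k
      refine DifferentiableOn.div (Differentiable.differentiableOn ?_)
        (Differentiable.differentiableOn ?_) ?_
      · exact ((differentiable_const _).mul (hp _)).sub (Differentiable.fun_sum fun j _ => hp _)
      · exact (differentiable_const _).sub (Differentiable.fun_sum fun j _ => hk j)
      · intro w hw
        exact sub_sum_ne_zero hc (hupd w (by simpa using hw))
    have := Complex.norm_le_of_forall_mem_frontier_norm_le Metric.isBounded_ball hd (C := 1)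
      (fun w hw => ?_) (z := z i) ?_
    · simpa using this
    · rw [frontier_ball _ one_ne_zero, mem_sphere_zero_iff_norm] at hw
      refine ih _ (hupd w hw.le) fun j hj => ?_
      rcases eq_or_ne j i with rfl | h
      · simpa using hw
      · simpa [Function.update_of_ne h] using hz1 j (by simp [h, hj])
    · rw [closure_ball _ one_ne_zero]
      simpa using hz i

end maximum

lemma norm_stdRIF_le_one {d : ℕ} {z : Fin d → ℂ} (hz : ∀ j, ‖z j‖ ≤ 1) : ‖stdRIF d z‖ ≤ 1 := by
  have key : ∀ c : ℝ, (d : ℝ) < c → ‖(c : ℂ) * ∏ k, z k -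
      ∑ j, ∏ k ∈ Finset.univ.erase j, z k‖ ≤ ‖(c : ℂ) - ∑ k, z k‖ := by
    intro c hc
    have hc' : (Fintype.card (Fin d) : ℝ) < c := by simpa using hc
    have h := norm_std_quotient_le_one hc' Finset.univ z hz (by simp)
    rwa [norm_div, div_le_one (norm_pos_iff.2 (sub_sum_ne_zero hc' hz))] at h
  have h1 : Continuous fun c : ℝ => ‖(c : ℂ) * ∏ k, z k -
      ∑ j, ∏ k ∈ Finset.univ.erase j, z k‖ := by fun_prop
  have h2 : Continuous fun c : ℝ => ‖(c : ℂ) - ∑ k, z k‖ := by fun_prop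
  -- At c = d the denominator can vanish on the closed polydisk, so the bound is proved for c > d in
  -- the form |numerator| ≤ |denominator| and passed to the limit c ↓ d. Where the denominator is
  -- zero the quotient is 0 by convention, and the bound persists.
  have h3 := le_of_tendsto_of_tendsto (b := 𝓝[>] (d : ℝ))
    (h1.continuousAt.tendsto.mono_left nhdsWithin_le_nhds)
    (h2.continuousAt.tendsto.mono_left nhdsWithin_le_nhds)
    (eventually_nhdsWithin_of_forall fun c hc => key c hc)
  rw [stdRIF, norm_div]
  exact div_le_one_of_le₀ (by simpa using h3) (norm_nonneg _)

section closedPolydisk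

variable {n : ℕ} {N : ℕ} {z : Fin (n + 1) → ℂ}

lemma norm_compPow_stdRIF_le_one (N : ℕ) (hz : ∀ j, ‖z j‖ ≤ 1) :
    ‖compPow (stdRIF (n + 1)) N z‖ ≤ 1 := by
  induction N with
  | zero => simpa [compPow] using hz _
  | succ N ih =>
    rw [compPow] at ih ⊢
    rw [Function.iterate_succ_apply']
    apply norm_stdRIF_le_one
    intro j
    rcases eq_or_ne j (Fin.last n) with rfl | h
    · simpa using ih
    · simpa [Function.update_of_ne h] using hz j

lemma one_lt_norm_eval_mobA {v : Fin n → ℂ} (hv : ∀ j, ‖v j‖ ≤ 1) (h1 : v ≠ 1) :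
    1 < ‖(mobA n).eval v‖ := by
  refine lt_of_lt_of_le ?_ (Complex.re_le_norm _)
  rw [eval_mobA]
  have hre : ∀ j, (v j).re ≤ 1 := fun j => (Complex.re_le_norm _).trans (hv j)
  obtain ⟨i, hi⟩ := Function.ne_iff.1 h1
  have hlt : (v i).re < 1 := by
    refine lt_of_le_of_ne (hre i) fun h => hi ?_
    have h2 : (v i).re = ‖v i‖ := le_antisymm (Complex.re_le_norm _) (h ▸ hv i)
    have h3 := Complex.re_eq_norm.1 h2
    exact Complex.ext (by simpa using h) (by simpa using (Complex.le_def.1 h3).2.symm)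
  have : ∑ k, (v k).re < ∑ k : Fin n, (1 : ℝ) :=
    Finset.sum_lt_sum (fun j _ => hre j) ⟨i, Finset.mem_univ i, hlt⟩
  simp at this
  simp
  linarith

/-- A zero of den_{N+1} = a den_N - num_N would give |a| |den_N| = |num_N| ≤ |den_N|, against |a| >
1 and den_N ≠ 0. -/
lemma eval_denPow_ne_zero_of_init_ne (N : ℕ) (hz : ∀ j, ‖z j‖ ≤ 1) (h1 : Fin.init z ≠ 1) :
    (denPow n N).eval z ≠ 0 := by
  induction N using Nat.strong_induction_on with
  | _ N ih =>
    rcases N with _ | N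
    · simp [eval_denPow, mobPow]
    · have hq := compPow_stdRIF_eq N z fun k hk => ih k (Nat.lt_succ_of_le hk)
      have hN := ih N (Nat.lt_succ_self N)
      have h2 := norm_compPow_stdRIF_le_one N hz
      have ha := one_lt_norm_eval_mobA (v := Fin.init z) (fun j => hz _) h1
      rw [hq, norm_div, div_le_one (norm_pos_iff.2 hN)] at h2
      rw [eval_denPow_succ]
      intro h0
      have h3 := congrArg norm (sub_eq_zero.1 h0)
      rw [norm_mul] at h3
      nlinarith [norm_pos_iff.2 hN]

lemma eval_denPow_of_init_eq (N : ℕ) (h1 : Fin.init z = 1) :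
    (denPow n (N + 1)).eval z = 2 ^ N * (1 - z (Fin.last n)) := by
  obtain ⟨-, h3, h4⟩ := eval_mobPow_one n N
  rw [eval_denPow, h1, h3, h4]
  ring

lemma eval_numPow_of_init_eq (N : ℕ) (h1 : Fin.init z = 1) :
    (numPow n (N + 1)).eval z = 2 ^ N * (z (Fin.last n) - 1) := by
  obtain ⟨h2, h3, -⟩ := eval_mobPow_one n N
  rw [eval_numPow, h1, h2, h3, eval_mobP_one]
  ring

lemma eq_one_of_init_eq (h1 : Fin.init z = 1) (h2 : z (Fin.last n) = 1) : z = 1 := by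
  funext j
  refine Fin.lastCases h2 (fun i => congrFun h1 i) j

lemma eval_denPow_ne_zero (hN : 1 ≤ N) (hz : ∀ j, ‖z j‖ ≤ 1) (h1 : z ≠ 1) :
    (denPow n N).eval z ≠ 0 := by
  by_cases h : Fin.init z = 1
  · obtain ⟨N, rfl⟩ := Nat.exists_eq_add_of_le' hN
    rw [eval_denPow_of_init_eq N h]
    refine mul_ne_zero (by simp) (sub_ne_zero.2 fun h2 => h1 (eq_one_of_init_eq h h2.symm))
  · exact eval_denPow_ne_zero_of_init_ne N hz h

lemma init_ne_one_of_mem_polydisk (hn : 1 ≤ n) (hz : z ∈ polydisk (n + 1)) : Fin.init z ≠ 1 := by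
  intro h
  have := hz (Fin.castSucc ⟨0, hn⟩)
  have h2 : z (Fin.castSucc ⟨0, hn⟩) = 1 := congrFun h ⟨0, hn⟩
  rw [h2, norm_one] at this
  exact lt_irrefl _ this

lemma compPow_stdRIF_eq_of_mem_polydisk (N : ℕ) (hn : 1 ≤ n) (hz : z ∈ polydisk (n + 1)) :
    compPow (stdRIF (n + 1)) N z = (numPow n N).eval z / (denPow n N).eval z :=
  compPow_stdRIF_eq N z fun k _ =>
    eval_denPow_ne_zero_of_init_ne k (fun j => (hz j).le) (init_ne_one_of_mem_polydisk hn hz)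

lemma isRationalForm_compPow (N : ℕ) (hn : 1 ≤ n) :
    IsRationalForm (compPow (stdRIF (n + 1)) N) (numPow n N) (denPow n N) := fun _ hz =>
  ⟨eval_denPow_ne_zero_of_init_ne N (fun j => (hz j).le) (init_ne_one_of_mem_polydisk hn hz),
    compPow_stdRIF_eq_of_mem_polydisk N hn hz⟩

end closedPolydisk

/-! ### Lowest terms, the singular set and the degree -/

section reducedForm

variable {d : ℕ} {φ : (Fin d → ℂ) → ℂ} {q p q' p' : MvPolynomial (Fin d) ℂ}

/-- Polynomials that agree on the polydisk are equal. -/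
lemma MvPolynomial.eq_of_eval_eq_on_polydisk
    (h : ∀ z ∈ polydisk d, q.eval z = p.eval z) : q = p := by
  refine MvPolynomial.funext_set (fun _ => Metric.ball (0 : ℂ) 1)
    (fun _ => infinite_of_mem_nhds 0 (Metric.ball_mem_nhds 0 one_pos)) fun z hz => h z fun j => ?_
  simpa using hz j (Set.mem_univ j)

lemma IsRationalForm.cross_mul (h : IsRationalForm φ q p) (h' : IsRationalForm φ q' p') :
    p * q' = q * p' := by
  refine MvPolynomial.eq_of_eval_eq_on_polydisk fun z hz => ?_
  obtain ⟨h1, h2⟩ := h z hz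
  obtain ⟨h3, h4⟩ := h' z hz
  rw [h2, div_eq_div_iff h1 h3] at h4
  simp only [map_mul]
  linear_combination -h4

lemma IsReducedForm.den_dvd (h' : IsReducedForm φ q' p') (h : IsRationalForm φ q p) : p' ∣ p := by
  have h1 := h.cross_mul h'.1
  exact h'.2.symm.dvd_of_dvd_mul_right (Dvd.intro_left q h1.symm)

lemma IsRationalForm.den_ne_zero (h : IsRationalForm φ q p) : p ≠ 0 := by
  rintro rfl
  exact (h 0 fun j => by simp).1 (by simp)

/-- Cancelling common factors. -/
lemma IsRationalForm.exists_reduced (h : IsRationalForm φ q p) :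
    ∃ q' p' g : MvPolynomial (Fin d) ℂ, IsReducedForm φ q' p' ∧ q = g * q' ∧ p = g * p' := by
  obtain ⟨q', p', g, hrel, hq, hp⟩ :=
    UniqueFactorizationMonoid.exists_reduced_factors' q p h.den_ne_zero
  refine ⟨q', p', g, ⟨fun z hz => ?_, hrel⟩, hq.symm, hp.symm⟩
  obtain ⟨h1, h2⟩ := h z hz
  rw [← hp, map_mul] at h1
  obtain ⟨h3, h4⟩ := mul_ne_zero_iff.1 h1
  refine ⟨h4, ?_⟩
  rw [h2, ← hq, ← hp, map_mul, map_mul, mul_div_mul_left _ _ h3]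

/-- A polynomial of degree zero in a variable does not depend on it. -/
lemma MvPolynomial.eval_update_of_degreeOf_eq_zero {i : Fin d} (h : p.degreeOf i = 0)
    (z : Fin d → ℂ) (w : ℂ) : p.eval (Function.update z i w) = p.eval z := by
  refine MvPolynomial.eval₂Hom_congr' rfl (fun j hj _ => ?_) rfl
  rcases eq_or_ne j i with rfl | hji
  · exact absurd h (MvPolynomial.mem_vars_iff_degreeOf_ne_zero.1 hj)
  · simp [Function.update_of_ne hji]

lemma MvPolynomial.degreeOf_le_of_dvd {i : Fin d} (h : q ∣ p) (hp : p ≠ 0) :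
    q.degreeOf i ≤ p.degreeOf i := by
  obtain ⟨g, rfl⟩ := h
  obtain ⟨h1, h2⟩ := mul_ne_zero_iff.1 hp
  rw [MvPolynomial.degreeOf_mul_eq h1 h2]
  exact Nat.le_add_right _ _

end reducedForm

section torusPoints

variable {n : ℕ} (N : ℕ)

lemma eval_mobDet_ne_zero {v : Fin n → ℂ} (hv : v ∈ torus n) (h1 : v ≠ 1) :
    (mobDet n).eval v ≠ 0 := by
  rw [eval_mobDet_torus hv]
  refine mul_ne_zero (fun h0 => by simpa [h0] using norm_eval_mobP hv) ?_
  have := one_lt_norm_eval_mobA (fun j => (hv j).le) h1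
  exact_mod_cast (by nlinarith : ‖(mobA n).eval v‖ ^ 2 - 1 ≠ 0)

/-- The torus accumulates at `(1, …, 1)`. -/
lemma frequently_mem_torus (hn : 1 ≤ n) : ∃ᶠ v in 𝓝 (1 : Fin n → ℂ), v ∈ torus n ∧ v ≠ 1 := by
  have hd : HasDerivAt (fun θ : ℝ => Complex.exp (θ * Complex.I)) Complex.I 0 := by
    have h1 : HasDerivAt (fun θ : ℝ => (θ : ℂ) * Complex.I) Complex.I 0 := by
      simpa using (Complex.ofRealCLM.hasDerivAt (x := (0 : ℝ))).mul_const Complex.I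
    simpa using h1.cexp
  have hne := hd.eventually_ne (c := 1) Complex.I_ne_zero
  have ht : Tendsto (fun (θ : ℝ) (_ : Fin n) => Complex.exp (θ * Complex.I)) (𝓝[≠] 0) (𝓝 1) := by
    refine tendsto_pi_nhds.2 fun j => ?_
    simpa using hd.continuousAt.tendsto.mono_left nhdsWithin_le_nhds
  refine ht.frequently (Eventually.frequently ?_)
  filter_upwards [hne] with θ hθ
  exact ⟨fun j => Complex.norm_exp_ofReal_mul_I θ, fun h => hθ (congrFun h ⟨0, hn⟩)⟩

end torusPoints

section singular

variable {n N : ℕ}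

/-- In general A · den + C · num = det^N, so numerator and denominator have no common zero where the
determinant is nonzero. -/
lemma eval_fst_mul_eval_denPow (z : Fin (n + 1) → ℂ) (h : (numPow n N).eval z = 0) :
    (mobPow n N).1.eval (Fin.init z) * (denPow n N).eval z =
      (mobDet n).eval (Fin.init z) ^ N := by
  rw [← eval_mobPow_det, eval_denPow]
  rw [eval_numPow] at h
  linear_combination (-(mobPow n N).2.1.eval (Fin.init z)) * h

/-- No coprimality of `numPow` and `denPow` is needed. If p(1) ≠ 0, then q = -p on the line ẑ = 1
gives q(1) ≠ 0. The zero set of the numerator is a graph through (1, …, 1); near that point q ≠ 0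
forces the denominator to vanish on it as well, hence the determinant, which is nonzero at torus
points v ≠ 1. -/
lemma eval_one_eq_zero_of_cross_mul (hn : 1 ≤ n) (hN : 1 ≤ N)
    {q p : MvPolynomial (Fin (n + 1)) ℂ} (h : denPow n N * q = numPow n N * p) :
    p.eval 1 = 0 := by
  have h' : ∀ z, (denPow n N).eval z * q.eval z = (numPow n N).eval z * p.eval z := fun z => by
    simpa only [map_mul] using congrArg (MvPolynomial.eval z) h
  obtain ⟨N, rfl⟩ := Nat.exists_eq_add_of_le' hN
  have hqp : q.eval 1 = -p.eval 1 := by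
    have hc : Continuous fun w : ℂ => (Function.update 1 (Fin.last n) w : Fin (n + 1) → ℂ) :=
      continuous_const.update _ continuous_id
    -- For w ≠ 1 the factor 2^N (1 - w) can be cancelled; density then reaches w = 1.
    have := Continuous.ext_on (dense_compl_singleton (1 : ℂ))
      ((MvPolynomial.continuous_eval q).comp hc) ((MvPolynomial.continuous_eval p).comp hc).neg
      fun w hw => ?_
    · simpa [Function.update_eq_self_iff] using congrFun this 1
    · have hi : Fin.init (Function.update 1 (Fin.last n) w : Fin (n + 1) → ℂ) = 1 := by
        rw [init_update_last]; rfl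
      have h2 := h' (Function.update 1 (Fin.last n) w)
      rw [eval_denPow_of_init_eq N hi, eval_numPow_of_init_eq N hi, Function.update_self] at h2
      have h3 : (2 : ℂ) ^ N * (1 - w) ≠ 0 :=
        mul_ne_zero (by simp) (sub_ne_zero.2 fun h0 => hw h0.symm)
      apply mul_left_cancel₀ h3
      simp only [Function.comp_apply, Pi.neg_apply]
      linear_combination h2
  by_contra hp
  have hq : q.eval 1 ≠ 0 := by simpa [hqp] using hp
  have hA : (mobPow n (N + 1)).1.eval 1 ≠ 0 := by rw [(eval_mobPow_one n N).1]; simp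
  let F : (Fin n → ℂ) → Fin (n + 1) → ℂ := fun v =>
    Fin.snoc v ((mobP n).eval v * (mobPow n (N + 1)).2.1.eval v / (mobPow n (N + 1)).1.eval v)
  have hF1 : F 1 = 1 := by
    apply eq_one_of_init_eq
    · simp [F]
    · obtain ⟨h1, h2, -⟩ := eval_mobPow_one n N
      simp [F, h1, h2, eval_mobP_one]
  have hFc : ContinuousAt F 1 := by
    refine continuousAt_pi.2 fun j => ?_
    refine Fin.lastCases ?_ (fun i => ?_) j
    · simp only [F, Fin.snoc_last]
      exact ((MvPolynomial.continuous_eval _).continuousAt.mul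
        (MvPolynomial.continuous_eval _).continuousAt).div
        (MvPolynomial.continuous_eval _).continuousAt hA
    · simpa only [F, Fin.snoc_castSucc] using (continuous_apply i).continuousAt
  have hev : ∀ᶠ v in 𝓝 (1 : Fin n → ℂ), q.eval (F v) ≠ 0 := by
    have : ContinuousAt (fun v => q.eval (F v)) 1 :=
      (MvPolynomial.continuous_eval q).continuousAt.comp hFc
    exact this.eventually_ne (by rwa [hF1])
  have hevA := (MvPolynomial.continuous_eval (mobPow n (N + 1)).1).continuousAt.eventually_ne hA
  obtain ⟨v, ⟨hv, hv1⟩, hqv, hAv⟩ := ((frequently_mem_torus hn).and_eventually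
    (hev.and hevA)).exists
  have hi : Fin.init (F v) = v := by simp [F]
  have hl : F v (Fin.last n) = (mobP n).eval v * (mobPow n (N + 1)).2.1.eval v /
    (mobPow n (N + 1)).1.eval v := by simp [F]
  have hnum : (numPow n (N + 1)).eval (F v) = 0 := by
    rw [eval_numPow, hi, hl, mul_div_cancel₀ _ hAv, sub_self]
  have hden := eval_fst_mul_eval_denPow (F v) hnum
  have h3 := h' (F v)
  rw [hnum, zero_mul] at h3
  rw [(mul_eq_zero.1 h3).resolve_right hqv, mul_zero, hi] at hden
  exact pow_ne_zero _ (eval_mobDet_ne_zero hv hv1) hden.symm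

lemma one_mem_torus (d : ℕ) : (1 : Fin d → ℂ) ∈ torus d := fun _ => by simp

/-- The only singularity of `φ_d^N` is `(1, …, 1)`. -/
lemma singularSet_compPow (hn : 1 ≤ n) (hN : 1 ≤ N) :
    singularSet (compPow (stdRIF (n + 1)) N) = {1} := by
  have hform := isRationalForm_compPow N hn
  ext ζ
  simp only [singularSet, Set.mem_ofPred_eq, Set.mem_singleton_iff]
  constructor
  · rintro ⟨hζ, q, p, hred, hp⟩
    by_contra h1
    obtain ⟨g, hg⟩ := hred.den_dvd hform
    apply eval_denPow_ne_zero hN (fun j => (hζ j).le) h1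
    rw [hg, map_mul, hp, zero_mul]
  · rintro rfl
    obtain ⟨q, p, -, hred, -⟩ := hform.exists_reduced
    exact ⟨one_mem_torus _, q, p, hred,
      eval_one_eq_zero_of_cross_mul hn hN (hform.cross_mul hred.1)⟩

end singular

section degree

variable {n N : ℕ}

lemma degreeOf_last_rename (p : MvPolynomial (Fin n) ℂ) :
    (MvPolynomial.rename Fin.castSucc p).degreeOf (Fin.last n) = 0 := by
  by_contra h
  have := MvPolynomial.vars_rename Fin.castSucc p
    (MvPolynomial.mem_vars_iff_degreeOf_ne_zero.2 h)
  simp [Fin.castSucc_ne_last] at this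

lemma degreeOf_last_numPow_le : (numPow n N).degreeOf (Fin.last n) ≤ 1 := by
  refine (MvPolynomial.degreeOf_sub_le _ _ _).trans (max_le ?_ ?_)
  · refine (MvPolynomial.degreeOf_mul_X_self _ _).trans ?_
    rw [degreeOf_last_rename]
  · rw [degreeOf_last_rename]
    exact zero_le_one

lemma degreeOf_last_denPow_le : (denPow n N).degreeOf (Fin.last n) ≤ 1 := by
  refine (MvPolynomial.degreeOf_sub_le _ _ _).trans (max_le ?_ ?_)
  · rw [degreeOf_last_rename]
    exact zero_le_one
  · refine (MvPolynomial.degreeOf_mul_X_self _ _).trans ?_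
    rw [degreeOf_last_rename]

/-- Every reduced form of `φ_d^N` has degree one in the last variable. -/
lemma max_degreeOf_last_eq_one (hn : 1 ≤ n) (hN : 1 ≤ N)
    {q p g : MvPolynomial (Fin (n + 1)) ℂ} (hq : numPow n N = g * q) (hp : denPow n N = g * p) :
    max (q.degreeOf (Fin.last n)) (p.degreeOf (Fin.last n)) = 1 := by
  have hden := (isRationalForm_compPow N hn).den_ne_zero
  have hpd := (MvPolynomial.degreeOf_le_of_dvd (i := Fin.last n)
    (Dvd.intro_left g hp.symm) hden).trans degreeOf_last_denPow_le
  have hqd : q.degreeOf (Fin.last n) ≤ 1 := by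
    by_cases h0 : numPow n N = 0
    · have hg : g ≠ 0 := by rintro rfl; exact hden (by simp [hp])
      have : q = 0 := by simpa [h0, hg] using hq
      simp [this]
    · exact (MvPolynomial.degreeOf_le_of_dvd (i := Fin.last n)
        (Dvd.intro_left g hq.symm) h0).trans degreeOf_last_numPow_le
  refine le_antisymm (max_le hqd hpd) ?_
  by_contra hlt
  have h0 : max (q.degreeOf (Fin.last n)) (p.degreeOf (Fin.last n)) = 0 := by omega
  obtain ⟨hq0, hp0⟩ := Nat.max_eq_zero_iff.1 h0
  obtain ⟨v, hv, hv1⟩ := (frequently_mem_torus hn).exists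
  have hcross : ∀ w : ℂ, (denPow n N).eval (Fin.snoc v w) * q.eval (Fin.snoc v 0) =
      (numPow n N).eval (Fin.snoc v w) * p.eval (Fin.snoc v 0) := by
    intro w
    have e : (Fin.snoc v w : Fin (n + 1) → ℂ) =
        Function.update (Fin.snoc v 0 : Fin (n + 1) → ℂ) (Fin.last n) w := by
      rw [Fin.update_snoc_last]
    have e1 := MvPolynomial.eval_update_of_degreeOf_eq_zero hq0 (Fin.snoc v 0) w
    have e2 := MvPolynomial.eval_update_of_degreeOf_eq_zero hp0 (Fin.snoc v 0) w
    rw [← e] at e1 e2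
    rw [← e1, ← e2, hq, hp, map_mul, map_mul]
    ring
  have hpne : p.eval (Fin.snoc v 0) ≠ 0 := by
    intro h
    refine eval_denPow_ne_zero (z := Fin.snoc v 0) hN (fun j => ?_) (fun h => ?_) ?_
    · refine Fin.lastCases ?_ (fun i => ?_) j
      · simp
      · simpa using (hv i).le
    · have := congrFun h (Fin.last n)
      simp at this
    · rw [hp, map_mul, h, mul_zero]
  have hdet := pow_ne_zero N (eval_mobDet_ne_zero hv hv1)
  have c0 := hcross 0
  have c1 := hcross 1
  simp only [eval_denPow, eval_numPow, Fin.init_snoc, Fin.snoc_last] at c0 c1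
  rw [← eval_mobPow_det] at hdet
  -- If the quotient did not depend on the last variable, its values at w = 0 and w = 1 would agree,
  -- and eliminating q would make the determinant vanish.
  have h1 : p.eval (Fin.snoc v 0) * ((mobPow n N).1.eval v * (mobPow n N).2.2.eval v -
    (mobP n).eval v * (mobPow n N).2.1.eval v ^ 2) = 0 := by
    linear_combination ((mobPow n N).2.2.eval v - (mobPow n N).2.1.eval v) * c0 -
      (mobPow n N).2.2.eval v * c1
  exact (mul_ne_zero hpne hdet) h1

lemma hasDegreeIn_last_compPow (hn : 1 ≤ n) (hN : 1 ≤ N) :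
    HasDegreeIn (compPow (stdRIF (n + 1)) N) (Fin.last n) 1 := by
  obtain ⟨q, p, g, hred, hq, hp⟩ := (isRationalForm_compPow N hn).exists_reduced
  exact ⟨q, p, hred, max_degreeOf_last_eq_one hn hN hq hp⟩

end degree

/-! ### Boundary values and the derivative -/

section nontangential

variable {d : ℕ} {f F : (Fin d → ℂ) → ℂ} {ζ : Fin d → ℂ} {c c' : ℂ}

/-- The radius t ↦ tζ stays in the region: |tζ_j - ζ_j| = 1 - t, which is less than α (1 - t)
because α > 1. -/
lemma approachRegion_neBot {α : ℝ} (hα : 1 < α) (hζ : ζ ∈ torus d) :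
    (𝓝[approachRegion α ζ] ζ).NeBot := by
  have ht : Tendsto (fun t : ℝ => (t : ℂ) • ζ) (𝓝[<] 1) (𝓝[approachRegion α ζ] ζ) := by
    refine tendsto_nhdsWithin_iff.2 ⟨?_, ?_⟩
    · have : Continuous fun t : ℝ => (t : ℂ) • ζ := by fun_prop
      simpa using (this.tendsto 1).mono_left nhdsWithin_le_nhds
    · filter_upwards [Ioo_mem_nhdsLT (show (0 : ℝ) < 1 from one_pos)] with t ht
      have hn : ∀ j, ‖((t : ℂ) • ζ) j‖ = t := fun j => by
        simp [hζ j, abs_of_pos ht.1]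
      refine ⟨fun j => (hn j).trans_lt ht.2, fun j => ?_⟩
      have h1 : ((t : ℂ) • ζ) j - ζ j = ((t - 1 : ℝ) : ℂ) * ζ j := by
        simp; ring
      rw [hn, h1, norm_mul, hζ j, Complex.norm_real, Real.norm_eq_abs, abs_of_neg (by linarith [ht.2])]
      nlinarith [ht.2]
  exact ht.neBot

lemma HasNTLimit.unique (hζ : ζ ∈ torus d) (h : HasNTLimit f ζ c) (h' : HasNTLimit f ζ c') :
    c = c' := by
  have := approachRegion_neBot one_lt_two hζ
  exact tendsto_nhds_unique (h 2 one_lt_two) (h' 2 one_lt_two)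

lemma hasNTLimit_of_continuousAt (h : ∀ z ∈ polydisk d, f z = F z) (hF : ContinuousAt F ζ) :
    HasNTLimit f ζ (F ζ) := by
  intro α _
  refine (hF.tendsto.mono_left nhdsWithin_le_nhds).congr' ?_
  filter_upwards [self_mem_nhdsWithin] with z hz
  exact (h z hz.1).symm

end nontangential

section derivative

variable {n N : ℕ}

/-- The derivative of `φ_d^N` in the last variable, as a rational function. -/
noncomputable def derivPow (n N : ℕ) (z : Fin (n + 1) → ℂ) : ℂ :=
  (mobDet n).eval (Fin.init z) ^ N / (denPow n N).eval z ^ 2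

lemma update_last_mem_polydisk {z : Fin (n + 1) → ℂ} (hz : z ∈ polydisk (n + 1)) {w : ℂ}
    (hw : ‖w‖ < 1) : Function.update z (Fin.last n) w ∈ polydisk (n + 1) := by
  intro j
  rcases eq_or_ne j (Fin.last n) with rfl | h
  · simpa using hw
  · simpa [Function.update_of_ne h] using hz j

lemma lastDeriv_compPow (hn : 1 ≤ n) {z : Fin (n + 1) → ℂ} (hz : z ∈ polydisk (n + 1)) :
    lastDeriv (compPow (stdRIF (n + 1)) N) z = derivPow n N z := by
  have hden := ((isRationalForm_compPow N hn) z hz).1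
  rw [eval_denPow] at hden
  have hev : (fun w => compPow (stdRIF (n + 1)) N (Function.update z (Fin.last n) w)) =ᶠ[
      𝓝 (z (Fin.last n))] fun w => ((mobPow n N).1.eval (Fin.init z) * w -
        (mobP n).eval (Fin.init z) * (mobPow n N).2.1.eval (Fin.init z)) /
        ((mobPow n N).2.2.eval (Fin.init z) - (mobPow n N).2.1.eval (Fin.init z) * w) := by
    have : ∀ᶠ w in 𝓝 (z (Fin.last n)), ‖w‖ < 1 :=
      continuous_norm.continuousAt.eventually_lt continuousAt_const (hz _)
    filter_upwards [this] with w hw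
    rw [compPow_stdRIF_eq_of_mem_polydisk N hn (update_last_mem_polydisk hz hw), eval_numPow,
      eval_denPow, init_update_last, Function.update_self]
  rw [lastDeriv, hev.deriv_eq]
  have hd1 := ((hasDerivAt_id (z (Fin.last n))).const_mul
    ((mobPow n N).1.eval (Fin.init z))).sub_const
      ((mobP n).eval (Fin.init z) * (mobPow n N).2.1.eval (Fin.init z))
  have hd2 := ((hasDerivAt_id (z (Fin.last n))).const_mul
    ((mobPow n N).2.1.eval (Fin.init z))).const_sub ((mobPow n N).2.2.eval (Fin.init z))
  refine (hd1.div hd2 hden).deriv.trans ?_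
  rw [derivPow, ← eval_mobPow_det, eval_denPow]
  simp only [id]
  congr 1
  ring

lemma continuous_init : Continuous (Fin.init : (Fin (n + 1) → ℂ) → Fin n → ℂ) :=
  continuous_pi fun j => continuous_apply j.castSucc

lemma measurable_derivPow : Measurable (derivPow n N) :=
  (((MvPolynomial.continuous_eval _).comp continuous_init).pow N).measurable.div
    ((MvPolynomial.continuous_eval _).pow 2).measurable

lemma hasNTLimit_lastDeriv (hn : 1 ≤ n) (hN : 1 ≤ N) {ζ : Fin (n + 1) → ℂ}
    (hζ : ζ ∈ torus (n + 1)) (h1 : ζ ≠ 1) :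
    HasNTLimit (lastDeriv (compPow (stdRIF (n + 1)) N)) ζ (derivPow n N ζ) := by
  refine hasNTLimit_of_continuousAt (fun z hz => lastDeriv_compPow hn hz) ?_
  exact (((MvPolynomial.continuous_eval _).comp continuous_init).pow N).continuousAt.div
    ((MvPolynomial.continuous_eval _).pow 2).continuousAt
    (pow_ne_zero 2 (eval_denPow_ne_zero hN (fun j => (hζ j).le) h1))

lemma hasNTLimit_compPow (hn : 1 ≤ n) (hN : 1 ≤ N) {ζ : Fin (n + 1) → ℂ}
    (hζ : ζ ∈ torus (n + 1)) (h1 : ζ ≠ 1) :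
    HasNTLimit (compPow (stdRIF (n + 1)) N) ζ
      ((numPow n N).eval ζ / (denPow n N).eval ζ) := by
  refine hasNTLimit_of_continuousAt
    (F := fun z => (numPow n N).eval z / (denPow n N).eval z)
    (fun z hz => compPow_stdRIF_eq_of_mem_polydisk N hn hz) ?_
  exact (MvPolynomial.continuous_eval _).continuousAt.div
    (MvPolynomial.continuous_eval _).continuousAt
    (eval_denPow_ne_zero hN (fun j => (hζ j).le) h1)

end derivative

section torusMeasure

variable {d n N : ℕ}

lemma continuous_expPoint : Continuous (expPoint : (Fin d → ℝ) → Fin d → ℂ) := by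
  unfold expPoint
  fun_prop

lemma expPoint_mem_torus (θ : Fin d → ℝ) : expPoint θ ∈ torus d := fun _ =>
  Complex.norm_exp_ofReal_mul_I _

lemma isClosed_torus (d : ℕ) : IsClosed (torus d) := by
  rw [torus, Set.ofPred_forall]
  exact isClosed_iInter fun j => isClosed_eq (by fun_prop) continuous_const

lemma eq_zero_of_expPoint_eq_one {θ : Fin d → ℝ}
    (hθ : θ ∈ Set.univ.pi fun _ : Fin d => Set.Ioc (-Real.pi) Real.pi)
    (h : expPoint θ = 1) : θ = 0 := by
  funext j
  have h1 : Complex.exp (θ j * Complex.I) = 1 := congrFun h j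
  have h2 := hθ j (Set.mem_univ j)
  have h3 := congrArg Complex.arg h1
  rw [Complex.arg_exp_mul_I, Complex.arg_one,
    (toIocMod_eq_self Real.two_pi_pos).2 ⟨h2.1, h2.2.trans_eq (by ring)⟩] at h3
  exact h3

lemma ae_torusMeasure : ∀ᵐ ζ ∂(torusMeasure (n + 1)), ζ ∈ torus (n + 1) ∧ ζ ≠ 1 := by
  have hmeas : MeasurableSet {ζ : Fin (n + 1) → ℂ | ζ ∈ torus (n + 1) ∧ ζ ≠ 1} :=
    (isClosed_torus _).measurableSet.inter (measurableSet_singleton 1).compl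
  rw [torusMeasure, ae_map_iff continuous_expPoint.aemeasurable hmeas]
  rw [ae_restrict_iff' (MeasurableSet.univ_pi fun _ => measurableSet_Ioc)]
  have : ∀ᵐ θ : Fin (n + 1) → ℝ, θ ≠ 0 := by
    simp [ae_iff]
  filter_upwards [this] with θ h0 hθ
  exact ⟨expPoint_mem_torus θ, fun h => h0 (eq_zero_of_expPoint_eq_one hθ h)⟩

/-- `φ_d^N` is a rational inner function. -/
lemma isRationalInner_compPow (hn : 1 ≤ n) (hN : 1 ≤ N) :
    IsRationalInner (compPow (stdRIF (n + 1)) N) where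
  rational := ⟨_, _, isRationalForm_compPow N hn⟩
  bounded := ⟨1, fun z hz => norm_compPow_stdRIF_le_one N fun j => (hz j).le⟩
  inner := by
    filter_upwards [ae_torusMeasure] with ζ hζ
    refine ⟨_, hasNTLimit_compPow hn hN hζ.1 hζ.2, ?_⟩
    rw [norm_div, norm_eval_numPow_torus N hζ.1, div_self]
    exact norm_ne_zero_iff.2 (eval_denPow_ne_zero hN (fun j => (hζ.1 j).le) hζ.2)

/-- Non-tangential limits are unique, so any admissible boundary function agrees almost everywhere
with the explicit rational one. -/
lemma boundaryMemLp_compPow_iff (hn : 1 ≤ n) (hN : 1 ≤ N) (r : ℝ) (U : Set (Fin (n + 1) → ℂ)) :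
    BoundaryMemLp (lastDeriv (compPow (stdRIF (n + 1)) N)) r U ↔
      MemLp (derivPow n N) (ENNReal.ofReal r) ((torusMeasure (n + 1)).restrict U) := by
  have hae := ae_restrict_of_ae (s := U) (ae_torusMeasure (n := n))
  constructor
  · rintro ⟨g, hg, hLp⟩
    refine hLp.ae_eq ?_
    filter_upwards [hg, hae] with ζ h1 h2
    exact h1.unique h2.1 (hasNTLimit_lastDeriv hn hN h2.1 h2.2)
  · intro h
    refine ⟨_, ?_, h⟩
    filter_upwards [hae] with ζ h2
    exact hasNTLimit_lastDeriv hn hN h2.1 h2.2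

end torusMeasure

/-! ### Fubini and integrals of powers of the norm -/

section fubini

/-- Integration over a cube, the last variable first. -/
lemma setLIntegral_pi_snoc {n : ℕ} {S : Set ℝ}
    {f : (Fin (n + 1) → ℝ) → ENNReal} (hf : Measurable f) :
    ∫⁻ θ in Set.univ.pi fun _ : Fin (n + 1) => S, f θ =
      ∫⁻ v in Set.univ.pi fun _ : Fin n => S, ∫⁻ t in S, f (Fin.snoc v t) := by
  let e := MeasurableEquiv.piFinSuccAbove (fun _ : Fin (n + 1) => ℝ) (Fin.last n)
  have he : MeasurePreserving e.symm volume volume :=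
    (volume_preserving_piFinSuccAbove (fun _ : Fin (n + 1) => ℝ) (Fin.last n)).symm
  have hes : ∀ x : ℝ × (Fin n → ℝ), e.symm x = Fin.snoc x.2 x.1 := fun x => by
    simp [e, MeasurableEquiv.piFinSuccAbove, Fin.insertNthEquiv, Fin.insertNth_last']
  have hpre : e.symm ⁻¹' (Set.univ.pi fun _ : Fin (n + 1) => S) =
      S ×ˢ (Set.univ.pi fun _ : Fin n => S) := by
    ext x
    simp only [Set.mem_preimage, hes, Set.mem_univ_pi, Set.mem_prod, Fin.forall_fin_succ']
    simp [and_comm]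
  rw [← he.setLIntegral_comp_preimage_emb e.symm.measurableEmbedding, hpre,
    Measure.volume_eq_prod, ← Measure.prod_restrict]
  rw [lintegral_prod_symm' (fun x => f (e.symm x)) (hf.comp e.symm.measurable)]
  simp only [hes]

end fubini

section power

lemma setLIntegral_norm_rpow_ne_top_iff {n : ℕ} (hn : 1 ≤ n) {ρ : ℝ} (hρ : 0 < ρ) (s : ℝ) :
    ∫⁻ v in Metric.ball (0 : Fin n → ℝ) ρ, ENNReal.ofReal (‖v‖ ^ (-s)) ≠ ⊤ ↔ s < n := by
  have : Nonempty (Fin n) := ⟨⟨0, hn⟩⟩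
  rw [lintegral_ofReal_ne_top_iff_integrable
    ((measurable_norm.pow_const _).aestronglyMeasurable)
    (Eventually.of_forall fun v => Real.rpow_nonneg (norm_nonneg v) _)]
  have h := integrableOn_fun_norm_addHaar (volume : Measure (Fin n → ℝ)) (f := fun y => y ^ (-s))
    (r := ρ)
  rw [IntegrableOn] at h
  rw [h, Module.finrank_fin_fun]
  have hcongr : IntegrableOn (fun y : ℝ => y ^ (n - 1) • y ^ (-s)) (Set.Ioo 0 ρ) ↔
      IntegrableOn (fun y : ℝ => y ^ ((n : ℝ) - 1 - s)) (Set.Ioo 0 ρ) := by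
    refine integrableOn_congr_fun (fun y hy => ?_) measurableSet_Ioo
    have h1 : (y : ℝ) ^ (n - 1) = y ^ ((n : ℝ) - 1) := by
      rw [← Real.rpow_natCast, Nat.cast_sub hn, Nat.cast_one]
    rw [smul_eq_mul, h1, ← Real.rpow_add hy.1, sub_eq_add_neg ((n : ℝ) - 1) s]
  rw [hcongr, intervalIntegral.integrableOn_Ioo_rpow_iff hρ]
  constructor <;> intro <;> linarith

end power

/-! ### Power means of the Poisson kernel in one variable -/

section slice

variable {C D : ℂ}

lemma sub_mul_ne_zero_of_norm_lt (h : ‖C‖ < ‖D‖) {w : ℂ} (hw : ‖w‖ ≤ 1) : D - C * w ≠ 0 := by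
  intro h0
  have := congrArg norm (sub_eq_zero.1 h0)
  rw [norm_mul] at this
  nlinarith [norm_nonneg C, norm_nonneg w]

lemma re_add_div_sub {w : ℂ} (hw : ‖w‖ = 1) :
    ((D + C * w) / (D - C * w)).re = (‖D‖ ^ 2 - ‖C‖ ^ 2) / ‖D - C * w‖ ^ 2 := by
  have h1 : ‖C‖ ^ 2 = ‖C * w‖ ^ 2 := by rw [norm_mul, hw, mul_one]
  rw [Complex.div_re, h1, ← Complex.normSq_eq_norm_sq, ← Complex.normSq_eq_norm_sq,
    ← Complex.normSq_eq_norm_sq (D - C * w), ← add_div]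
  congr 1
  generalize C * w = E
  simp only [Complex.normSq_apply, Complex.add_re, Complex.add_im, Complex.sub_re, Complex.sub_im]
  ring

lemma continuous_poisson (h : ‖C‖ < ‖D‖) : Continuous fun t : ℝ =>
    (‖D‖ ^ 2 - ‖C‖ ^ 2) / ‖D - C * Complex.exp (t * Complex.I)‖ ^ 2 := by
  refine continuous_const.div (by fun_prop) fun t => ?_
  exact pow_ne_zero 2 (norm_ne_zero_iff.2
    (sub_mul_ne_zero_of_norm_lt h (Complex.norm_exp_ofReal_mul_I t).le))

/-- The integral of the Poisson kernel. -/
lemma integral_poisson (h : ‖C‖ < ‖D‖) :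
    ∫ t in -Real.pi..Real.pi,
      (‖D‖ ^ 2 - ‖C‖ ^ 2) / ‖D - C * Complex.exp (t * Complex.I)‖ ^ 2 = 2 * Real.pi := by
  have hD : D ≠ 0 := norm_pos_iff.1 ((norm_nonneg C).trans_lt h)
  have hdiff : DifferentiableOn ℂ (fun w => (D + C * w) / (D - C * w)) (Metric.closedBall 0 1) :=
    DifferentiableOn.div (by fun_prop) (by fun_prop) fun w hw =>
      sub_mul_ne_zero_of_norm_lt h (by simpa using hw)
  have hdc : DiffContOnCl ℂ (fun w => (D + C * w) / (D - C * w)) (Metric.ball 0 |1|) := by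
    apply DifferentiableOn.diffContOnCl
    rw [abs_one, closure_ball _ one_ne_zero]
    exact hdiff
  -- The kernel is the real part of (D + Cw)/(D - Cw), holomorphic on the disk with value 1 at the
  -- centre.
  have havg := hdc.circleAverage
  have hci : CircleIntegrable (fun w => (D + C * w) / (D - C * w)) 0 1 :=
    (hdiff.continuousOn.mono Metric.sphere_subset_closedBall).circleIntegrable zero_le_one
  have hre := Complex.reCLM.circleAverage_comp_comm hci
  rw [havg] at hre
  simp only [mul_zero, add_zero, sub_zero, div_self hD] at hre
  rw [Real.circleAverage_eq_integral_add (-Real.pi),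
    intervalIntegral.integral_comp_add_right
      (fun t => (Complex.reCLM ∘ fun w => (D + C * w) / (D - C * w)) (circleMap 0 1 t))] at hre
  have hint : ∀ t : ℝ, (Complex.reCLM ∘ fun w => (D + C * w) / (D - C * w)) (circleMap 0 1 t) =
      (‖D‖ ^ 2 - ‖C‖ ^ 2) / ‖D - C * Complex.exp (t * Complex.I)‖ ^ 2 := by
    intro t
    have : circleMap 0 1 t = Complex.exp (t * Complex.I) := by simp [circleMap]
    rw [Function.comp_apply, this, Complex.reCLM_apply,
      re_add_div_sub (Complex.norm_exp_ofReal_mul_I t)]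
  simp only [hint] at hre
  rw [show 0 + -Real.pi = -Real.pi by ring, show 2 * Real.pi + -Real.pi = Real.pi by ring] at hre
  have hpi := Real.pi_pos
  rw [smul_eq_mul, inv_mul_eq_iff_eq_mul₀ (by positivity)] at hre
  simpa using hre

lemma lintegral_poisson (h : ‖C‖ < ‖D‖) :
    ∫⁻ t in Set.Ioc (-Real.pi) Real.pi, ENNReal.ofReal
      ((‖D‖ ^ 2 - ‖C‖ ^ 2) / ‖D - C * Complex.exp (t * Complex.I)‖ ^ 2) =
        ENNReal.ofReal (2 * Real.pi) := by
  have hle : -Real.pi ≤ Real.pi := by linarith [Real.pi_pos]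
  rw [← integral_poisson h, intervalIntegral.integral_of_le hle, ofReal_integral_eq_lintegral_ofReal]
  · exact ((continuous_poisson h).intervalIntegrable _ _).1
  · refine Eventually.of_forall fun t => div_nonneg ?_ (sq_nonneg _)
    nlinarith [norm_nonneg C]

/-- Upper bound for the `r`-th power mean of the Poisson kernel. -/
lemma lintegral_poisson_rpow_le (h : ‖C‖ < ‖D‖) {r : ℝ} (hr : 1 ≤ r) :
    ∫⁻ t in Set.Ioc (-Real.pi) Real.pi, ENNReal.ofReal
      ((‖D‖ ^ 2 - ‖C‖ ^ 2) / ‖D - C * Complex.exp (t * Complex.I)‖ ^ 2) ^ r ≤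
        ENNReal.ofReal ((4 * ‖D‖ ^ 2 / (‖D‖ ^ 2 - ‖C‖ ^ 2)) ^ (r - 1) * (2 * Real.pi)) := by
  have hΔ : 0 < ‖D‖ ^ 2 - ‖C‖ ^ 2 := by nlinarith [norm_nonneg C]
  rw [ENNReal.ofReal_mul (by positivity), ← lintegral_poisson h,
    ← lintegral_const_mul _ (continuous_poisson h).measurable.ennreal_ofReal]
  refine lintegral_mono fun t => ?_
  set w := Complex.exp (t * Complex.I) with hw
  have hw1 : ‖w‖ = 1 := Complex.norm_exp_ofReal_mul_I t
  have hpos : 0 < ‖D - C * w‖ := norm_pos_iff.2 (sub_mul_ne_zero_of_norm_lt h hw1.le)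
  have hlow : ‖D‖ - ‖C‖ ≤ ‖D - C * w‖ := by
    have := norm_sub_norm_le D (C * w)
    rwa [norm_mul, hw1, mul_one] at this
  set g := (‖D‖ ^ 2 - ‖C‖ ^ 2) / ‖D - C * w‖ ^ 2 with hg
  have hg0 : 0 < g := by positivity
  -- The maximum of the kernel is (|D| + |C|)/(|D| - |C|) = (|D| + |C|)²/Δ. Then g^r = g^{r-1} g is
  -- at most a constant times g, whose integral is 2π.
  have hle : g ≤ 4 * ‖D‖ ^ 2 / (‖D‖ ^ 2 - ‖C‖ ^ 2) := by
    rw [hg, div_le_div_iff₀ (by positivity) hΔ]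
    have h1 : (‖D‖ - ‖C‖) ^ 2 ≤ ‖D - C * w‖ ^ 2 := by gcongr
    have h2 : (‖D‖ + ‖C‖) ^ 2 ≤ 4 * ‖D‖ ^ 2 := by nlinarith [norm_nonneg C]
    calc (‖D‖ ^ 2 - ‖C‖ ^ 2) * (‖D‖ ^ 2 - ‖C‖ ^ 2)
        = (‖D‖ + ‖C‖) ^ 2 * (‖D‖ - ‖C‖) ^ 2 := by ring
      _ ≤ _ := by gcongr
  have hgr : g ^ r = g ^ (r - 1) * g := by
    conv_rhs => rw [← Real.rpow_one g, ← Real.rpow_mul hg0.le, one_mul]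
    rw [← Real.rpow_add hg0, sub_add_cancel]
  rw [ENNReal.ofReal_rpow_of_pos hg0, ← ENNReal.ofReal_mul (by positivity), hgr]
  apply ENNReal.ofReal_le_ofReal
  gcongr

/-- Lower bound for the `r`-th power mean of the Poisson kernel near its peak. -/
lemma le_lintegral_poisson_rpow (h : ‖C‖ < ‖D‖) {B δ r : ℝ} (hB : ‖C‖ ≤ B)
    (hD : 1 / 2 ≤ ‖D‖) (harg : |(C / D).arg| < δ / 2) (hδ : ‖D‖ ^ 2 - ‖C‖ ^ 2 < δ / 2)
    (hr : 1 ≤ r) :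
    ENNReal.ofReal ((((2 + B) ^ 2)⁻¹) ^ r * (‖D‖ ^ 2 - ‖C‖ ^ 2) ^ (1 - r)) ≤
      ∫⁻ t in Set.Ioo (-δ) δ, ENNReal.ofReal
        ((‖D‖ ^ 2 - ‖C‖ ^ 2) / ‖D - C * Complex.exp (t * Complex.I)‖ ^ 2) ^ r := by
  have hΔ : 0 < ‖D‖ ^ 2 - ‖C‖ ^ 2 := by nlinarith [norm_nonneg C]
  set Δ := ‖D‖ ^ 2 - ‖C‖ ^ 2 with hΔdef
  have hB0 : 0 ≤ B := (norm_nonneg C).trans hB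
  have hD0 : D ≠ 0 := norm_pos_iff.1 ((norm_nonneg C).trans_lt h)
  -- This angle aligns C w with D, so that |D - Cw| = |D| - |C| = Δ/(|D| + |C|) ≤ 2Δ, using |D| ≥
  -- 1/2. On an interval of length Δ starting there |D - Cw| stays below (2 + B)Δ, so the kernel is
  -- at least a multiple of 1/Δ, and its r-th power integral at least a multiple of Δ^{1-r}.
  set t₀ := -(C / D).arg with ht₀
  have hpeak : C * Complex.exp (t₀ * Complex.I) = D * (‖C / D‖ : ℝ) := by
    have h1 := Complex.norm_mul_exp_arg_mul_I (C / D)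
    have h2 : C = D * (C / D) := by field_simp
    conv_lhs => rw [h2, ← h1]
    rw [mul_assoc, mul_assoc, ← Complex.exp_add]
    simp [ht₀]
  have hpeakn : ‖D - C * Complex.exp (t₀ * Complex.I)‖ ≤ 2 * Δ := by
    have h1 : D - D * (‖C / D‖ : ℝ) = D * ((1 - ‖C / D‖ : ℝ) : ℂ) := by push_cast; ring
    have h2 : 0 ≤ 1 - ‖C / D‖ := by
      rw [norm_div, sub_nonneg, div_le_one (by linarith)]; exact h.le
    rw [hpeak, h1, norm_mul, Complex.norm_real, Real.norm_of_nonneg h2, norm_div, mul_sub,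
      mul_div_cancel₀ _ (by linarith), mul_one]
    nlinarith [norm_nonneg C]
  have hnear : ∀ t ∈ Set.Ioo t₀ (t₀ + Δ), ‖D - C * Complex.exp (t * Complex.I)‖ ≤ Δ * (2 + B) := by
    intro t ht
    have h1 : ‖Complex.exp (t₀ * Complex.I) - Complex.exp (t * Complex.I)‖ ≤ Δ := by
      have h2 : Complex.exp (t₀ * Complex.I) - Complex.exp (t * Complex.I) =
          -(Complex.exp (t₀ * Complex.I) * (Complex.exp (Complex.I * ((t - t₀ : ℝ) : ℂ)) - 1)) := by
        rw [mul_sub, ← Complex.exp_add, mul_one, neg_sub]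
        congr 2
        push_cast
        ring
      rw [h2, norm_neg, norm_mul, Complex.norm_exp_ofReal_mul_I, one_mul]
      refine (Real.norm_exp_I_mul_ofReal_sub_one_le).trans ?_
      rw [Real.norm_eq_abs, abs_of_pos (by linarith [ht.1])]
      linarith [ht.2]
    have h3 : D - C * Complex.exp (t * Complex.I) = (D - C * Complex.exp (t₀ * Complex.I)) +
        C * (Complex.exp (t₀ * Complex.I) - Complex.exp (t * Complex.I)) := by ring
    rw [h3]
    refine (norm_add_le _ _).trans ?_
    rw [norm_mul]
    have : ‖C‖ * ‖Complex.exp (t₀ * Complex.I) - Complex.exp (t * Complex.I)‖ ≤ B * Δ := by gcongr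
    linarith
  have hsub : Set.Ioo t₀ (t₀ + Δ) ⊆ Set.Ioo (-δ) δ := by
    have := abs_lt.1 harg
    exact Set.Ioo_subset_Ioo (by linarith) (by linarith)
  have hconst : ENNReal.ofReal ((((2 + B) ^ 2)⁻¹) ^ r * Δ ^ (1 - r)) =
      ∫⁻ _ in Set.Ioo t₀ (t₀ + Δ), ENNReal.ofReal (((2 + B) ^ 2)⁻¹ * Δ⁻¹) ^ r := by
    rw [setLIntegral_const, Real.volume_Ioo, add_sub_cancel_left,
      ENNReal.ofReal_rpow_of_pos (by positivity), ← ENNReal.ofReal_mul (by positivity),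
      Real.mul_rpow (by positivity) (by positivity), Real.inv_rpow hΔ.le, mul_assoc,
      Real.rpow_sub hΔ, Real.rpow_one]
    congr 2
    rw [div_eq_mul_inv, mul_comm]
  rw [hconst]
  refine le_trans ?_ (lintegral_mono_set hsub)
  refine setLIntegral_mono' measurableSet_Ioo fun t ht => ?_
  refine ENNReal.rpow_le_rpow (ENNReal.ofReal_le_ofReal ?_) (by linarith)
  have hpos : 0 < ‖D - C * Complex.exp (t * Complex.I)‖ := norm_pos_iff.2
    (sub_mul_ne_zero_of_norm_lt h (Complex.norm_exp_ofReal_mul_I t).le)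
  have hn := hnear t ht
  rw [← mul_inv, inv_eq_one_div, div_le_div_iff₀ (by positivity) (by positivity), one_mul]
  calc ‖D - C * Complex.exp (t * Complex.I)‖ ^ 2 ≤ (Δ * (2 + B)) ^ 2 := by gcongr
    _ = Δ * ((2 + B) ^ 2 * Δ) := by ring

end slice

/-! ### Two-sided quadratic bounds for |a|² - 1 -/

section modulus

variable {n : ℕ}

lemma norm_sq_eval_mobA_expPoint (v : Fin n → ℝ) :
    ‖(mobA n).eval (expPoint v)‖ ^ 2 - 1 = 2 * (∑ k, (1 - Real.cos (v k))) +
      (∑ k, (1 - Real.cos (v k))) ^ 2 + (∑ k, Real.sin (v k)) ^ 2 := by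
  have hre : ((mobA n).eval (expPoint v)).re = 1 + ∑ k, (1 - Real.cos (v k)) := by
    rw [eval_mobA]
    simp [expPoint, Complex.exp_ofReal_mul_I_re]
    ring
  have him : ((mobA n).eval (expPoint v)).im = -∑ k, Real.sin (v k) := by
    rw [eval_mobA]
    simp [expPoint, Complex.exp_ofReal_mul_I_im]
  rw [← Complex.normSq_eq_norm_sq, Complex.normSq_apply, hre, him]
  ring

lemma le_norm_sq_eval_mobA {v : Fin n → ℝ} (hv : ∀ k, |v k| ≤ Real.pi) :
    4 / Real.pi ^ 2 * ‖v‖ ^ 2 ≤ ‖(mobA n).eval (expPoint v)‖ ^ 2 - 1 := by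
  have h1 : 2 / Real.pi ^ 2 * ∑ k, (v k) ^ 2 ≤ ∑ k, (1 - Real.cos (v k)) := by
    rw [Finset.mul_sum]
    exact Finset.sum_le_sum fun k _ => by linarith [Real.cos_le_one_sub_mul_cos_sq (hv k)]
  have h2 : ‖v‖ ^ 2 ≤ ∑ k, (v k) ^ 2 := by
    have h0 : 0 ≤ ∑ k, (v k) ^ 2 := Finset.sum_nonneg fun k _ => sq_nonneg _
    rw [← Real.sq_sqrt h0]
    gcongr
    refine (pi_norm_le_iff_of_nonneg (Real.sqrt_nonneg _)).2 fun k => ?_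
    rw [Real.norm_eq_abs]
    refine Real.abs_le_sqrt (Finset.single_le_sum (f := fun k => v k ^ 2)
      (fun k _ => sq_nonneg _) (Finset.mem_univ k))
  rw [norm_sq_eval_mobA_expPoint]
  have h3 : 2 / Real.pi ^ 2 * ‖v‖ ^ 2 ≤ 2 / Real.pi ^ 2 * ∑ k, (v k) ^ 2 := by gcongr
  have h4 : 4 / Real.pi ^ 2 * ‖v‖ ^ 2 = 2 * (2 / Real.pi ^ 2 * ‖v‖ ^ 2) := by ring
  nlinarith [sq_nonneg (∑ k, (1 - Real.cos (v k))), sq_nonneg (∑ k, Real.sin (v k))]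

/-- With s = ∑ (1 - cos v_k): 2s contributes n, and s² and the squared sum of sines contribute n²
each. The term s² is kept quadratic in ‖v‖ for all v by bounding one factor s by 2n. -/
lemma norm_sq_eval_mobA_le (v : Fin n → ℝ) :
    ‖(mobA n).eval (expPoint v)‖ ^ 2 - 1 ≤ (n + 2 * n ^ 2) * ‖v‖ ^ 2 := by
  have hk : ∀ k, |v k| ≤ ‖v‖ := fun k => norm_le_pi_norm v k
  have hsq : ∀ k, v k ^ 2 ≤ ‖v‖ ^ 2 := fun k => by
    rw [← sq_abs]; exact pow_le_pow_left₀ (abs_nonneg _) (hk k) 2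
  have h1 : ∑ k, (1 - Real.cos (v k)) ≤ n * (‖v‖ ^ 2 / 2) := by
    refine (Finset.sum_le_card_nsmul _ _ (‖v‖ ^ 2 / 2) fun k _ => ?_).trans_eq (by simp)
    linarith [Real.one_sub_sq_div_two_le_cos (x := v k), hsq k]
  have h2 : ∑ k, (1 - Real.cos (v k)) ≤ n * 2 := by
    refine (Finset.sum_le_card_nsmul _ _ 2 fun k _ => ?_).trans_eq (by simp)
    linarith [Real.neg_one_le_cos (v k)]
  have h0 : 0 ≤ ∑ k, (1 - Real.cos (v k)) :=
    Finset.sum_nonneg fun k _ => by linarith [Real.cos_le_one (v k)]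
  have h3 : |∑ k, Real.sin (v k)| ≤ n * ‖v‖ := by
    refine (Finset.abs_sum_le_sum_abs _ _).trans ?_
    refine (Finset.sum_le_card_nsmul _ _ ‖v‖ fun k _ => ?_).trans_eq (by simp)
    exact (Real.abs_sin_le_abs).trans (hk k)
  have h4 : (∑ k, Real.sin (v k)) ^ 2 ≤ (n * ‖v‖) ^ 2 := by
    rw [← sq_abs]; exact pow_le_pow_left₀ (abs_nonneg _) h3 2
  rw [norm_sq_eval_mobA_expPoint]
  nlinarith [mul_le_mul h1 h2 h0 (by positivity)]

end modulus

/-! ### The integrability cutoff -/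

section integrability

variable {n N : ℕ}

/-- The numerator of the derivative is det^N, and on the torus |det|^N = (|a|² - 1)^N = |D|² - |C|².
-/
lemma norm_derivPow_expPoint (v : Fin n → ℝ) (t : ℝ) :
    ‖derivPow n N (expPoint (Fin.snoc v t : Fin (n + 1) → ℝ))‖ =
      (‖(mobPow n N).2.2.eval (expPoint v)‖ ^ 2 - ‖(mobPow n N).2.1.eval (expPoint v)‖ ^ 2) /
        ‖(mobPow n N).2.2.eval (expPoint v) -
          (mobPow n N).2.1.eval (expPoint v) * Complex.exp (t * Complex.I)‖ ^ 2 := by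
  have hi : Fin.init (expPoint (Fin.snoc v t : Fin (n + 1) → ℝ)) = expPoint v := by
    funext j
    simp [Fin.init, expPoint]
  have hl : expPoint (Fin.snoc v t : Fin (n + 1) → ℝ) (Fin.last n) =
      Complex.exp (t * Complex.I) := by simp [expPoint]
  have ha : 1 ≤ ‖(mobA n).eval (expPoint v)‖ := by
    by_cases h1 : expPoint v = 1
    · rw [h1, eval_mobA_one, norm_one]
    · exact (one_lt_norm_eval_mobA (fun j => (expPoint_mem_torus v j).le) h1).le
  have hdet : ‖(mobDet n).eval (expPoint v)‖ = ‖(mobA n).eval (expPoint v)‖ ^ 2 - 1 := by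
    rw [eval_mobDet_torus (expPoint_mem_torus v), norm_mul, norm_eval_mobP (expPoint_mem_torus v),
      one_mul, Complex.norm_real, Real.norm_of_nonneg (by nlinarith)]
  rw [derivPow, norm_div, norm_pow, norm_pow, eval_denPow, hi, hl, hdet,
    norm_sq_sub_norm_sq N (expPoint_mem_torus v)]

lemma norm_snd_lt_norm_thd {v : Fin n → ℝ} (h1 : expPoint v ≠ 1) :
    ‖(mobPow n N).2.1.eval (expPoint v)‖ < ‖(mobPow n N).2.2.eval (expPoint v)‖ := by
  have ha := one_lt_norm_eval_mobA (fun j => (expPoint_mem_torus v j).le) h1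
  have h2 := norm_sq_sub_norm_sq N (expPoint_mem_torus v)
  have h3 : 0 < (‖(mobA n).eval (expPoint v)‖ ^ 2 - 1) ^ N := pow_pos (by nlinarith) N
  exact lt_of_pow_lt_pow_left₀ 2 (norm_nonneg _) (by linarith)

lemma memLp_derivPow_iff {r : ℝ} (hr : 1 ≤ r) {U : Set (Fin (n + 1) → ℂ)} (hU : MeasurableSet U) :
    MemLp (derivPow n N) (ENNReal.ofReal r) ((torusMeasure (n + 1)).restrict U) ↔
      ∫⁻ θ in (expPoint ⁻¹' U) ∩ (Set.univ.pi fun _ : Fin (n + 1) => Set.Ioc (-Real.pi) Real.pi),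
        ENNReal.ofReal ‖derivPow n N (expPoint θ)‖ ^ r < ⊤ := by
  have hm : Measurable fun ζ => ENNReal.ofReal ‖derivPow n N ζ‖ ^ r :=
    measurable_derivPow.norm.ennreal_ofReal.pow_const _
  rw [MemLp, and_iff_right measurable_derivPow.aestronglyMeasurable,
    eLpNorm_lt_top_iff_lintegral_rpow_enorm_lt_top (by simp; linarith) (by simp),
    ENNReal.toReal_ofReal (by linarith), torusMeasure,
    Measure.restrict_map continuous_expPoint.measurable hU,
    Measure.restrict_restrict (continuous_expPoint.measurable hU)]
  simp only [← ofReal_norm]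
  rw [lintegral_map hm continuous_expPoint.measurable]

lemma measurable_derivPow_expPoint_rpow (r : ℝ) : Measurable fun θ : Fin (n + 1) → ℝ =>
    ENNReal.ofReal ‖derivPow n N (expPoint θ)‖ ^ r :=
  (measurable_derivPow.comp continuous_expPoint.measurable).norm.ennreal_ofReal.pow_const _

lemma lt_cutoff_iff (hN : 1 ≤ N) (r : ℝ) :
    r < cutoff (n + 1) N ↔ 2 * N * (r - 1) < n := by
  have : (0 : ℝ) < 2 * N := by positivity
  rw [cutoff, ← sub_lt_iff_lt_add', lt_div_iff₀ this]
  push_cast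
  rw [add_sub_cancel_right, mul_comm]

/-- Below the cutoff the derivative is `L^r` on the torus. -/
lemma memLp_derivPow_of_lt_cutoff (hn : 1 ≤ n) (hN : 1 ≤ N) {r : ℝ} (hr : 1 ≤ r)
    (hcut : r < cutoff (n + 1) N) :
    MemLp (derivPow n N) (ENNReal.ofReal r) ((torusMeasure (n + 1)).restrict Set.univ) := by
  have hpi := Real.pi_pos
  rw [memLp_derivPow_iff hr MeasurableSet.univ, Set.preimage_univ, Set.univ_inter,
    setLIntegral_pi_snoc (measurable_derivPow_expPoint_rpow r)]
  obtain ⟨B, hB⟩ : ∃ B, ∀ v ∈ Metric.closedBall (0 : Fin n → ℝ) Real.pi,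
      ‖(mobPow n N).2.2.eval (expPoint v)‖ ≤ B :=
    (isCompact_closedBall _ _).exists_bound_of_continuousOn
      ((MvPolynomial.continuous_eval _).comp continuous_expPoint).continuousOn
  set S := Set.univ.pi fun _ : Fin n => Set.Ioc (-Real.pi) Real.pi with hS
  have hSm : MeasurableSet S := MeasurableSet.univ_pi fun _ => measurableSet_Ioc
  have hSabs : ∀ v ∈ S, ∀ k, |v k| ≤ Real.pi := fun v hv k =>
    abs_le.2 ⟨(hv k (Set.mem_univ k)).1.le, (hv k (Set.mem_univ k)).2⟩
  have hSball : ∀ v ∈ S, ‖v‖ ≤ Real.pi := fun v hv =>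
    (pi_norm_le_iff_of_nonneg hpi.le).2 (hSabs v hv)
  set K := (4 * B ^ 2 / (4 / Real.pi ^ 2) ^ N) ^ (r - 1) * (2 * Real.pi) with hK
  have hfin : ∫⁻ v in S, ENNReal.ofReal (‖v‖ ^ (-(2 * N * (r - 1)))) ≠ ⊤ := by
    refine ne_top_of_le_ne_top ((setLIntegral_norm_rpow_ne_top_iff hn
      (show 0 < Real.pi + 1 by linarith) _).2 ((lt_cutoff_iff hN r).1 hcut)) ?_
    refine lintegral_mono_set fun v hv => ?_
    rw [mem_ball_zero_iff]
    linarith [hSball v hv]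
  refine lt_of_le_of_lt (b := ∫⁻ v in S, ENNReal.ofReal K *
    ENNReal.ofReal (‖v‖ ^ (-(2 * N * (r - 1))))) ?_ ?_
  · refine lintegral_mono_ae ?_
    rw [ae_restrict_iff' hSm]
    have : Nonempty (Fin n) := ⟨⟨0, hn⟩⟩
    have hne : ∀ᵐ v : Fin n → ℝ, v ≠ 0 := by simp [ae_iff]
    filter_upwards [hne] with v hv0 hvS
    have hv1 : expPoint v ≠ 1 := fun h => hv0 (eq_zero_of_expPoint_eq_one hvS h)
    simp only [norm_derivPow_expPoint]
    refine (lintegral_poisson_rpow_le (norm_snd_lt_norm_thd hv1) hr).trans ?_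
    have hvpos : 0 < ‖v‖ := norm_pos_iff.2 hv0
    rw [← ENNReal.ofReal_mul (by positivity), norm_sq_sub_norm_sq N (expPoint_mem_torus v)]
    apply ENNReal.ofReal_le_ofReal
    have hlow := le_norm_sq_eval_mobA (hSabs v hvS)
    have hBv := hB v (by simpa using hSball v hvS)
    have h1 : 4 * ‖(mobPow n N).2.2.eval (expPoint v)‖ ^ 2 /
        (‖(mobA n).eval (expPoint v)‖ ^ 2 - 1) ^ N ≤
          (4 * B ^ 2 / (4 / Real.pi ^ 2) ^ N) * ‖v‖ ^ (-(2 * N : ℝ)) := by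
      have h2 : ‖v‖ ^ (-(2 * N : ℝ)) = ((‖v‖ ^ 2) ^ N)⁻¹ := by
        rw [Real.rpow_neg hvpos.le, ← pow_mul, ← Real.rpow_natCast]
        push_cast
        rfl
      rw [h2, ← div_eq_mul_inv, div_div, ← mul_pow]
      gcongr
    have h3 : ‖v‖ ^ (-(2 * N * (r - 1))) = (‖v‖ ^ (-(2 * N : ℝ))) ^ (r - 1) := by
      rw [← Real.rpow_mul hvpos.le]
      congr 1
      ring
    have hD := norm_nonneg ((mobPow n N).2.2.eval (expPoint v))
    have hq : 0 ≤ 4 * ‖(mobPow n N).2.2.eval (expPoint v)‖ ^ 2 /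
        (‖(mobA n).eval (expPoint v)‖ ^ 2 - 1) ^ N :=
      div_nonneg (by positivity) (pow_nonneg (le_trans (by positivity) hlow) N)
    calc _ ≤ ((4 * B ^ 2 / (4 / Real.pi ^ 2) ^ N) * ‖v‖ ^ (-(2 * N : ℝ))) ^ (r - 1) *
          (2 * Real.pi) := by
          gcongr
      _ = _ := by
          rw [Real.mul_rpow (by positivity) (by positivity), ← h3, hK]
          ring
  · rw [lintegral_const_mul _ (measurable_norm.pow_const _).ennreal_ofReal]
    exact ENNReal.mul_lt_top ENNReal.ofReal_lt_top hfin.lt_top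

lemma expPoint_zero (d : ℕ) : expPoint (0 : Fin d → ℝ) = 1 := by
  funext j
  simp [expPoint]

/-- Local integrability at the singularity forces the exponent to be below the cutoff. -/
lemma lt_cutoff_of_memLp_derivPow (hn : 1 ≤ n) (hN : 1 ≤ N) {r : ℝ} (hr : 1 ≤ r)
    {U : Set (Fin (n + 1) → ℂ)} (hU : U ∈ 𝓝 1)
    (h : MemLp (derivPow n N) (ENNReal.ofReal r) ((torusMeasure (n + 1)).restrict U)) :
    r < cutoff (n + 1) N := by
  obtain ⟨V, hVU, hVo, hV1⟩ := mem_nhds_iff.1 hU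
  have hV := (memLp_derivPow_iff hr hVo.measurableSet).1
    (h.mono_measure (Measure.restrict_mono hVU le_rfl))
  have hVn : expPoint ⁻¹' V ∈ 𝓝 (0 : Fin (n + 1) → ℝ) :=
    continuous_expPoint.continuousAt.preimage_mem_nhds
      (hVo.mem_nhds (by rwa [expPoint_zero]))
  obtain ⟨ε, hε, hball⟩ := Metric.mem_nhds_iff.1 hVn
  -- The bound 1 < π keeps the cube inside (-π, π]^d.
  set δ := min ε 1 with hδdef
  have hδ : 0 < δ := lt_min hε one_pos
  have hpi3 := Real.pi_gt_three
  have hcube : (Set.univ.pi fun _ : Fin (n + 1) => Set.Ioo (-δ) δ) ⊆ (expPoint ⁻¹' V) ∩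
      (Set.univ.pi fun _ : Fin (n + 1) => Set.Ioc (-Real.pi) Real.pi) := by
    intro θ hθ
    have habs : ∀ k, |θ k| < δ := fun k => abs_lt.2 (hθ k (Set.mem_univ k))
    refine ⟨hball ?_, fun k _ => ?_⟩
    · rw [mem_ball_zero_iff]
      refine lt_of_lt_of_le ((pi_norm_lt_iff hδ).2 habs) (min_le_left _ _)
    · have h1 := hθ k (Set.mem_univ k)
      have h2 : δ ≤ 1 := min_le_right _ _
      exact ⟨by linarith [h1.1], by linarith [h1.2]⟩
  have hlt := (lintegral_mono_set hcube).trans_lt hV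
  rw [setLIntegral_pi_snoc (measurable_derivPow_expPoint_rpow r)] at hlt
  obtain ⟨M, rfl⟩ := Nat.exists_eq_add_of_le' hN
  set Cf : (Fin n → ℝ) → ℂ := fun v => (mobPow n (M + 1)).2.1.eval (expPoint v) with hCf
  set Df : (Fin n → ℝ) → ℂ := fun v => (mobPow n (M + 1)).2.2.eval (expPoint v) with hDf
  have hCc : Continuous Cf := (MvPolynomial.continuous_eval _).comp continuous_expPoint
  have hDc : Continuous Df := (MvPolynomial.continuous_eval _).comp continuous_expPoint
  have hC0 : Cf 0 = 2 ^ M := by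
    simp only [hCf, expPoint_zero, (eval_mobPow_one n M).2.1]
  have hD0 : Df 0 = 2 ^ M := by
    simp only [hDf, expPoint_zero, (eval_mobPow_one n M).2.2]
  have hD0n : ‖Df 0‖ = 2 ^ M := by rw [hD0]; simp
  have hC0n : ‖Cf 0‖ = 2 ^ M := by rw [hC0]; simp
  have h2M : (1 : ℝ) ≤ 2 ^ M := one_le_pow₀ (by norm_num)
  -- At v = 0 one has C = D = 2^M, so Δ = 0 and C/D = 1 has argument 0; by continuity the hypotheses
  -- of `le_lintegral_poisson_rpow` hold near 0.
  have e1 : ∀ᶠ v in 𝓝 (0 : Fin n → ℝ), 1 / 2 < ‖Df v‖ :=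
    continuousAt_const.eventually_lt hDc.norm.continuousAt (by rw [hD0n]; linarith)
  have e2 : ∀ᶠ v in 𝓝 (0 : Fin n → ℝ), ‖Cf v‖ < 2 ^ M + 1 :=
    hCc.norm.continuousAt.eventually_lt continuousAt_const (by rw [hC0n]; linarith)
  have e3 : ∀ᶠ v in 𝓝 (0 : Fin n → ℝ), ‖Df v‖ ^ 2 - ‖Cf v‖ ^ 2 < δ / 2 :=
    ((hDc.norm.pow 2).sub (hCc.norm.pow 2)).continuousAt.eventually_lt continuousAt_const
      (by simp only [Pi.sub_apply, Pi.pow_apply]; rw [hC0n, hD0n]; linarith)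
  have hquot : Cf 0 / Df 0 = 1 := by rw [hC0, hD0, div_self (by simp)]
  have e4 : ∀ᶠ v in 𝓝 (0 : Fin n → ℝ), |(Cf v / Df v).arg| < δ / 2 := by
    have hq : ContinuousAt (fun v => Cf v / Df v) 0 :=
      hCc.continuousAt.div hDc.continuousAt (by rw [hD0]; simp)
    have ha : ContinuousAt (fun v => |(Cf v / Df v).arg|) 0 := by
      refine ContinuousAt.abs (ContinuousAt.comp (g := Complex.arg) ?_ hq)
      rw [hquot]
      exact Complex.continuousAt_arg (by simp)
    exact ha.eventually_lt continuousAt_const (by simp [hquot]; linarith)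
  obtain ⟨ρ, hρ, hρball⟩ := Metric.eventually_nhds_iff_ball.1
    ((e1.and e2).and (e3.and e4))
  set σ := min ρ δ with hσdef
  have hσ : 0 < σ := lt_min hρ hδ
  set K : ℝ := ((2 + (2 ^ M + 1)) ^ 2)⁻¹ ^ r * ((n + 2 * n ^ 2 : ℝ) ^ (M + 1)) ^ (1 - r) with hK
  have hn0 : (0 : ℝ) < n := by exact_mod_cast hn
  have hKpos : 0 < K := by positivity
  rw [lt_cutoff_iff hN, ← setLIntegral_norm_rpow_ne_top_iff hn hσ]
  have hle : ∫⁻ v in Metric.ball (0 : Fin n → ℝ) σ, ENNReal.ofReal K *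
      ENNReal.ofReal (‖v‖ ^ (-(2 * ((M + 1 : ℕ) : ℝ) * (r - 1)))) ≤
      ∫⁻ v in Set.univ.pi fun _ : Fin n => Set.Ioo (-δ) δ, ∫⁻ t in Set.Ioo (-δ) δ,
        ENNReal.ofReal ‖derivPow n (M + 1) (expPoint (Fin.snoc v t : Fin (n + 1) → ℝ))‖ ^ r := by
    have hsub : Metric.ball (0 : Fin n → ℝ) σ ⊆ Set.univ.pi fun _ : Fin n => Set.Ioo (-δ) δ := by
      intro v hv k _
      rw [mem_ball_zero_iff] at hv
      exact abs_lt.1 (((norm_le_pi_norm v k).trans_lt hv).trans_le (min_le_right _ _))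
    refine le_trans ?_ (lintegral_mono_set hsub)
    refine lintegral_mono_ae ?_
    rw [ae_restrict_iff' measurableSet_ball]
    have : Nonempty (Fin n) := ⟨⟨0, hn⟩⟩
    have hne : ∀ᵐ v : Fin n → ℝ, v ≠ 0 := by simp [ae_iff]
    filter_upwards [hne] with v hv0 hvσ
    have hvS : v ∈ Set.univ.pi fun _ : Fin n => Set.Ioc (-Real.pi) Real.pi := by
      intro k _
      have h1 := hsub hvσ k (Set.mem_univ k)
      have h2 : δ ≤ 1 := min_le_right _ _
      exact ⟨by linarith [h1.1], by linarith [h1.2]⟩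
    have hv1 : expPoint v ≠ 1 := fun h => hv0 (eq_zero_of_expPoint_eq_one hvS h)
    obtain ⟨⟨b1, b2⟩, b3, b4⟩ := hρball v
      (Metric.ball_subset_ball (min_le_left _ _) hvσ)
    simp only [norm_derivPow_expPoint]
    refine le_trans ?_ (le_lintegral_poisson_rpow (norm_snd_lt_norm_thd hv1) b2.le b1.le b4 b3 hr)
    have hvpos : 0 < ‖v‖ := norm_pos_iff.2 hv0
    rw [← ENNReal.ofReal_mul hKpos.le]
    apply ENNReal.ofReal_le_ofReal
    have hup := norm_sq_eval_mobA_le v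
    have hlo := one_lt_norm_eval_mobA (fun j => (expPoint_mem_torus v j).le) hv1
    have hpos : 0 < ‖(mobA n).eval (expPoint v)‖ ^ 2 - 1 := by nlinarith
    rw [norm_sq_sub_norm_sq (M + 1) (expPoint_mem_torus v), hK, mul_assoc]
    gcongr ?_ * ?_
    have h1 : ‖v‖ ^ (-(2 * ((M + 1 : ℕ) : ℝ) * (r - 1))) = ((‖v‖ ^ 2) ^ (M + 1)) ^ (1 - r) := by
      rw [← pow_mul, ← Real.rpow_natCast, ← Real.rpow_mul hvpos.le]
      congr 1
      push_cast
      ring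
    rw [h1, ← Real.mul_rpow (by positivity) (by positivity), ← mul_pow]
    -- The exponent 1 - r is nonpositive, so the upper bound on |a|² - 1 gives a lower bound here.
    refine Real.rpow_le_rpow_of_nonpos (by positivity) ?_ (by linarith)
    gcongr
  rw [lintegral_const_mul _ (measurable_norm.pow_const _).ennreal_ofReal] at hle
  intro htop
  rw [htop, ENNReal.mul_top (by simpa using hKpos)] at hle
  exact absurd hlt (not_lt.2 hle)

end integrability

section index

variable {n N : ℕ}

lemma boundaryMemLp_univ_iff (hn : 1 ≤ n) (hN : 1 ≤ N) {r : ℝ} (hr : 1 ≤ r) :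
    BoundaryMemLp (lastDeriv (compPow (stdRIF (n + 1)) N)) r Set.univ ↔ r < cutoff (n + 1) N := by
  rw [boundaryMemLp_compPow_iff hn hN]
  exact ⟨lt_cutoff_of_memLp_derivPow hn hN hr univ_mem, memLp_derivPow_of_lt_cutoff hn hN hr⟩

lemma isLocalDerivIndex_compPow (hn : 1 ≤ n) (hN : 1 ≤ N) :
    IsLocalDerivIndex (compPow (stdRIF (n + 1)) N) 1 (cutoff (n + 1) N) := by
  have hset : {r : ℝ | 1 ≤ r ∧ ∃ U ∈ 𝓝 (1 : Fin (n + 1) → ℂ),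
      BoundaryMemLp (lastDeriv (compPow (stdRIF (n + 1)) N)) r U} =
        Set.Ico 1 (cutoff (n + 1) N) := by
    ext r
    simp only [Set.mem_ofPred_eq, Set.mem_Ico]
    refine and_congr_right fun hr => ⟨?_, fun h => ?_⟩
    · rintro ⟨U, hU, h⟩
      exact lt_cutoff_of_memLp_derivPow hn hN hr hU ((boundaryMemLp_compPow_iff hn hN r U).1 h)
    · exact ⟨Set.univ, univ_mem, (boundaryMemLp_univ_iff hn hN hr).2 h⟩
  rw [IsLocalDerivIndex, hset]
  refine isLUB_Ico ((lt_cutoff_iff hN 1).2 ?_)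
  have : (0 : ℝ) < n := by exact_mod_cast hn
  simpa using this

end index

/-! ### Common factors of numerator and denominator -/

section commonFactors

open MvPolynomial in
lemma degreeOf_eq_zero_of_mem_supported {d : ℕ} {i : Fin d} {c : MvPolynomial (Fin d) ℂ}
    (h : c ∈ supported ℂ ({i}ᶜ : Set (Fin d))) : c.degreeOf i = 0 := by
  by_contra h0
  exact (mem_supported.1 h (mem_vars_iff_degreeOf_ne_zero.2 h0)) rfl

open MvPolynomial in
lemma degreeOf_quadratic_le {d : ℕ} {i : Fin d} {a b c : MvPolynomial (Fin d) ℂ}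
    (ha : a ∈ supported ℂ ({i}ᶜ : Set (Fin d))) (hb : b ∈ supported ℂ ({i}ᶜ : Set (Fin d)))
    (hc : c ∈ supported ℂ ({i}ᶜ : Set (Fin d))) :
    (a * X i ^ 2 + (b * X i + c)).degreeOf i ≤ 2 ∧ (b * X i + c).degreeOf i ≤ 1 := by
  have h1 : (b * X i + c).degreeOf i ≤ 1 := by
    refine (degreeOf_add_le _ _ _).trans (max_le ?_ ?_)
    · refine (degreeOf_mul_X_self _ _).trans ?_
      rw [degreeOf_eq_zero_of_mem_supported hb]
    · rw [degreeOf_eq_zero_of_mem_supported hc]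
      exact zero_le_one
  refine ⟨(degreeOf_add_le _ _ _).trans (max_le ?_ (h1.trans one_le_two)), h1⟩
  refine (degreeOf_mul_le _ _ _).trans ?_
  rw [degreeOf_eq_zero_of_mem_supported ha, degreeOf_X_self_pow]

open MvPolynomial in
/-- A polynomial of degree zero in every variable is a unit, unless it vanishes. -/
lemma isUnit_of_forall_degreeOf_eq_zero {d : ℕ} {g : MvPolynomial (Fin d) ℂ} (h0 : g ≠ 0)
    (h : ∀ i, g.degreeOf i = 0) : IsUnit g := by
  have hv : g.vars = ∅ := Finset.eq_empty_of_forall_notMem fun i hi =>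
    mem_vars_iff_degreeOf_ne_zero.1 hi (h i)
  have hc := vars_eq_empty_iff_eq_C.1 hv
  rw [hc]
  exact (isUnit_iff_ne_zero.2 fun h1 => h0 (by rw [hc, h1, map_zero])).map C

variable {n N : ℕ}

lemma dvd_rename_mobDet {g : MvPolynomial (Fin (n + 1)) ℂ} (hg : Prime g)
    (hq : g ∣ numPow n N) (hp : g ∣ denPow n N) :
    g ∣ MvPolynomial.rename Fin.castSucc (mobDet n) := by
  refine hg.dvd_of_dvd_pow (n := N) ?_
  have h := congrArg (MvPolynomial.rename (R := ℂ) Fin.castSucc) (mobPow_det n N)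
  rw [map_pow, map_sub, map_mul, map_mul, map_pow] at h
  have : MvPolynomial.rename Fin.castSucc (mobDet n) ^ N =
      MvPolynomial.rename Fin.castSucc (mobPow n N).1 * denPow n N +
        MvPolynomial.rename Fin.castSucc (mobPow n N).2.1 * numPow n N := by
    rw [← h, numPow, denPow, map_mul]
    ring
  rw [this]
  exact dvd_add (Dvd.dvd.mul_left hp _) (Dvd.dvd.mul_left hq _)

end commonFactors

/-! ### Two variables: contact order -/

section twoVariables

open MvPolynomial in
lemma irreducible_X_sub_one : Irreducible (X 0 - 1 : MvPolynomial (Fin 2) ℂ) := by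
  have hdeg : (X 0 - 1 : MvPolynomial (Fin 2) ℂ).totalDegree = 1 := by
    rw [sub_eq_add_neg, totalDegree_add_eq_left_of_totalDegree_lt] <;>
      simp [totalDegree_neg]
  refine irreducible_of_totalDegree_eq_one hdeg fun x hx => ?_
  have := hx 0
  simp at this
  exact isUnit_of_dvd_one (by simpa using this)

/-- For d = 2 the determinant is -2(z₁ - 1)², so a common prime factor is associated to z₁ - 1; but
the denominator does not vanish at (1, 0). -/
lemma isReducedForm_compPow_two {K : ℕ} (hK : 1 ≤ K) :
    IsReducedForm (compPow (stdRIF 2) K) (numPow 1 K) (denPow 1 K) := by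
  refine ⟨isRationalForm_compPow K le_rfl, IsRelPrime.symm ?_⟩
  obtain ⟨K, rfl⟩ := Nat.exists_eq_add_of_le' hK
  rw [UniqueFactorizationMonoid.isRelPrime_iff_no_prime_factors
    (isRationalForm_compPow (K + 1) le_rfl).den_ne_zero]
  intro g hp hq hg
  have hdet : MvPolynomial.rename Fin.castSucc (mobDet 1) =
      MvPolynomial.C (-2) * (MvPolynomial.X 0 - 1 : MvPolynomial (Fin 2) ℂ) ^ 2 := by
    refine MvPolynomial.funext fun x => ?_
    simp [MvPolynomial.eval_rename, mobDet, eval_mobA, eval_mobR, eval_mobP]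
    ring
  have h1 := dvd_rename_mobDet hg hq hp
  have h2 : g ∣ (MvPolynomial.X 0 - 1 : MvPolynomial (Fin 2) ℂ) := by
    rw [hdet] at h1
    rcases hg.dvd_or_dvd h1 with h | h
    · exact absurd (isUnit_of_dvd_unit h ((isUnit_iff_ne_zero.2 (by norm_num)).map _)) hg.not_isUnit
    · exact hg.dvd_of_dvd_pow h
  obtain ⟨k, hk⟩ := (hg.irreducible.dvd_symm irreducible_X_sub_one h2).trans hp
  have h3 := congrArg (MvPolynomial.eval ![1, 0]) hk
  rw [eval_denPow_of_init_eq K (by funext j; fin_cases j; rfl)] at h3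
  simp at h3

lemma hasContactOrder_compPow {K : ℕ} (hK : 1 ≤ K) :
    HasContactOrder (compPow (stdRIF 2) K) 0 0 (2 * K) := by
  have hzero : expPoint ![0, 0] = (1 : Fin 2 → ℂ) := by
    have : (![0, 0] : Fin 2 → ℝ) = 0 := by funext j; fin_cases j <;> rfl
    rw [this, expPoint_zero]
  refine ⟨hasDegreeIn_last_compPow le_rfl hK, ?_, numPow 1 K, denPow 1 K,
    isReducedForm_compPow_two hK, ?_⟩
  · rw [hzero, singularSet_compPow le_rfl hK]
    rfl
  obtain ⟨K, rfl⟩ := Nat.exists_eq_add_of_le' hK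
  set V : ℝ → Fin 1 → ℝ := fun θ _ => θ with hV
  have hVc : Continuous V := continuous_pi fun _ => continuous_id
  have hV0 : V 0 = 0 := rfl
  set A : ℝ → ℂ := fun θ => (mobPow 1 (K + 1)).1.eval (expPoint (V θ)) with hA
  set C : ℝ → ℂ := fun θ => (mobPow 1 (K + 1)).2.1.eval (expPoint (V θ)) with hC
  set D : ℝ → ℂ := fun θ => (mobPow 1 (K + 1)).2.2.eval (expPoint (V θ)) with hD
  set P : ℝ → ℂ := fun θ => (mobP 1).eval (expPoint (V θ)) with hP
  have hAD : ∀ θ, ‖A θ‖ = ‖D θ‖ := fun θ =>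
    norm_mobPow_fst (K + 1) (expPoint_mem_torus (V θ))
  have hDc : Continuous D :=
    (MvPolynomial.continuous_eval _).comp (continuous_expPoint.comp hVc)
  have hD0 : D 0 ≠ 0 := by
    simp only [hD, hV0, expPoint_zero, (eval_mobPow_one 1 K).2.2]
    simp
  have hDev : ∀ᶠ θ in 𝓝 0, D θ ≠ 0 := hDc.continuousAt.eventually_ne hD0
  refine ⟨fun θ => P θ * C θ / A θ, ?_, ?_⟩
  · filter_upwards [hDev] with θ hθ w
    have hAθ : A θ ≠ 0 := norm_ne_zero_iff.1 (by rw [hAD]; exact norm_ne_zero_iff.2 hθ)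
    have hi : Fin.init ![Complex.exp ((θ : ℂ) * Complex.I), w] = expPoint (V θ) := by
      funext j
      fin_cases j
      rfl
    have hl : (![Complex.exp ((θ : ℂ) * Complex.I), w] : Fin 2 → ℂ) (Fin.last 1) = w := rfl
    rw [eval_numPow, hi, hl, eq_div_iff hAθ, sub_eq_zero, mul_comm]
  -- Since |P| = 1 and |A| = |D|, the zero ψ = PC/A has |ψ| = |C|/|D|.
  · have hform : ∀ᶠ θ in 𝓝 (0 : ℝ), (‖(mobA 1).eval (expPoint (V θ))‖ ^ 2 - 1) ^ (K + 1) /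
        ‖D θ‖ ^ 2 = 1 - ‖P θ * C θ / A θ‖ ^ 2 := by
      filter_upwards [hDev] with θ hθ
      have hPn : ‖P θ‖ = 1 := norm_eval_mobP (expPoint_mem_torus (V θ))
      rw [norm_div, norm_mul, hPn, one_mul, hAD, ← norm_sq_sub_norm_sq (K + 1)
        (expPoint_mem_torus (V θ)), div_pow, sub_div, div_self
        (pow_ne_zero 2 (norm_ne_zero_iff.2 hθ))]
    have hnorm : ∀ θ, ‖V θ‖ = |θ| := fun θ => by simp [hV, pi_norm_const]
    have hmod : (fun θ => ‖(mobA 1).eval (expPoint (V θ))‖ ^ 2 - 1) =Θ[𝓝 0]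
        fun θ : ℝ => θ ^ 2 := by
      have hpi := Real.pi_pos
      have hnear : ∀ᶠ θ : ℝ in 𝓝 0, |θ| ≤ Real.pi := by
        filter_upwards [Metric.ball_mem_nhds (0 : ℝ) hpi] with θ hθ
        rw [mem_ball_zero_iff] at hθ
        exact hθ.le
      constructor
      · refine Asymptotics.IsBigO.of_bound 3 ?_
        filter_upwards [hnear] with θ hθ
        have h1 := le_norm_sq_eval_mobA (v := V θ) (fun _ => hθ)
        have h2 := norm_sq_eval_mobA_le (V θ)
        rw [hnorm, sq_abs] at h1 h2
        rw [Real.norm_of_nonneg (le_trans (by positivity) h1), Real.norm_of_nonneg (sq_nonneg θ)]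
        norm_num at h2 ⊢
        linarith
      · refine Asymptotics.IsBigO.of_bound (Real.pi ^ 2 / 4) ?_
        filter_upwards [hnear] with θ hθ
        have h1 := le_norm_sq_eval_mobA (v := V θ) (fun _ => hθ)
        rw [hnorm, sq_abs] at h1
        rw [Real.norm_of_nonneg (le_trans (by positivity) h1), Real.norm_of_nonneg (sq_nonneg θ)]
        calc θ ^ 2 = Real.pi ^ 2 / 4 * (4 / Real.pi ^ 2 * θ ^ 2) := by field_simp
          _ ≤ _ := by gcongr
    have hDθ : (fun θ => ‖D θ‖ ^ 2) =Θ[𝓝 0] fun _ : ℝ => (1 : ℝ) :=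
      have hne : ‖D 0‖ ^ 2 ≠ 0 := pow_ne_zero 2 (norm_ne_zero_iff.2 hD0)
      ((Asymptotics.isEquivalent_const_iff_tendsto hne).2
        (hDc.norm.pow 2).continuousAt.tendsto).isTheta.trans
          (Asymptotics.isTheta_const_const hne one_ne_zero)
    have := (hmod.pow (K + 1)).div hDθ
    refine (EventuallyEq.symm hform).trans_isTheta ?_
    simpa only [div_one, sub_zero, pow_mul] using this

end twoVariables

/-! ### Three variables: the second composition of φ₃ -/

section threeVariables

open MvPolynomial

lemma denPow_two_two : denPow 2 2 = denomThreeTwo := by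
  refine MvPolynomial.funext fun x => ?_
  have hl : x (Fin.last 2) = x 2 := rfl
  have h0 : Fin.init x 0 = x 0 := rfl
  have h1 : Fin.init x 1 = x 1 := rfl
  have he0 : (Finset.univ.erase 0 : Finset (Fin 2)) = {1} := rfl
  have he1 : (Finset.univ.erase 1 : Finset (Fin 2)) = {0} := rfl
  simp only [eval_denPow, mobPow, map_add, map_mul, eval_mobA, eval_mobR, eval_mobP, hl, h0, h1,
    Fin.sum_univ_two, Fin.prod_univ_two, he0, he1, Finset.prod_singleton, map_one, map_zero,
    denomThreeTwo, map_sub, map_pow, eval_X, map_ofNat]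
  push_cast
  ring

/-- The numerator of the second composition of `φ_3`, sorted by powers of one of the first two
variables. -/
lemma numPow_two_two {i j : Fin 3} (hij : (i, j) = (0, 1) ∨ (i, j) = (1, 0)) :
    numPow 2 2 = ((3 * X j - 1) ^ 2 * X 2 - X j * (3 * X j - 2)) * X i ^ 2 +
      (((X j - 2 * X j * (3 * X j - 1)) * X 2 - X j * (3 - 2 * X j)) * X i + X j ^ 2 * X 2) := by
  refine MvPolynomial.funext fun x => ?_
  have hl : x (Fin.last 2) = x 2 := rfl
  have h0 : Fin.init x 0 = x 0 := rfl
  have h1 : Fin.init x 1 = x 1 := rfl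
  have he0 : (Finset.univ.erase 0 : Finset (Fin 2)) = {1} := rfl
  have he1 : (Finset.univ.erase 1 : Finset (Fin 2)) = {0} := rfl
  rcases hij with h | h <;> obtain ⟨rfl, rfl⟩ := Prod.mk.inj h <;>
  · simp only [eval_numPow, mobPow, map_add, map_mul, eval_mobA, eval_mobR, eval_mobP, hl, h0, h1,
      Fin.sum_univ_two, Fin.prod_univ_two, he0, he1, Finset.prod_singleton, map_one, map_zero,
      map_sub, map_pow, eval_X, map_ofNat]
    push_cast
    ring

/-- The denominator of the second composition of `φ_3`, sorted by powers of one of the first two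
variables. -/
lemma denomThreeTwo_eq {i j : Fin 3} (hij : (i, j) = (0, 1) ∨ (i, j) = (1, 0)) :
    denomThreeTwo = 1 * X i ^ 2 + ((-6 + 3 * X j + 2 * X 2 - 3 * X j * X 2) * X i +
      (9 - 6 * X j - 3 * X 2 + X j ^ 2 + 2 * X j * X 2)) := by
  rcases hij with h | h <;> obtain ⟨rfl, rfl⟩ := Prod.mk.inj h <;>
  · rw [denomThreeTwo]
    ring

lemma max_degreeOf_two_two {i j : Fin 3} (hij : (i, j) = (0, 1) ∨ (i, j) = (1, 0)) :
    max ((numPow 2 2).degreeOf i) (denomThreeTwo.degreeOf i) = 2 := by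
  have hj : (X j : MvPolynomial (Fin 3) ℂ) ∈ supported ℂ ({i}ᶜ : Set (Fin 3)) := by
    refine X_mem_supported.2 ?_
    rcases hij with h | h <;> obtain ⟨rfl, rfl⟩ := Prod.mk.inj h <;> simp
  have h2 : (X 2 : MvPolynomial (Fin 3) ℂ) ∈ supported ℂ ({i}ᶜ : Set (Fin 3)) := by
    refine X_mem_supported.2 ?_
    rcases hij with h | h <;> obtain ⟨rfl, rfl⟩ := Prod.mk.inj h <;> simp
  refine le_antisymm (max_le ?_ ?_) (le_max_of_le_right ?_)
  · rw [numPow_two_two hij]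
    refine (degreeOf_quadratic_le ?_ ?_ ?_).1 <;>
    with_reducible apply_rules [add_mem, sub_mem, pow_mem, mul_mem, ofNat_mem, one_mem]
  · rw [denomThreeTwo_eq hij]
    refine (degreeOf_quadratic_le ?_ ?_ ?_).1 <;>
    with_reducible apply_rules [add_mem, sub_mem, pow_mem, mul_mem, neg_mem, ofNat_mem, one_mem]
  · rw [denomThreeTwo_eq hij, one_mul, degreeOf_add_eq_of_degreeOf_lt]
    · rw [degreeOf_X_self_pow]
    · rw [degreeOf_X_self_pow, Nat.lt_succ_iff]
      refine (degreeOf_quadratic_le (one_mem _) ?_ ?_).2 <;>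
      with_reducible apply_rules [add_mem, sub_mem, pow_mem, mul_mem, neg_mem, ofNat_mem, one_mem]

/-- Substituting a constant for the last variable. -/
noncomputable def substLast (c : ℂ) : MvPolynomial (Fin 3) ℂ →ₐ[ℂ] MvPolynomial (Fin 3) ℂ :=
  aeval ![X 0, X 1, C c]

lemma substLast_eq_self {g : MvPolynomial (Fin 3) ℂ} (hg : g.degreeOf 2 = 0) (c : ℂ) :
    substLast c g = g := by
  refine MvPolynomial.funext fun x => ?_
  have h1 : eval x (substLast c g) = eval (Function.update x 2 c) g := by
    have : ((eval x).comp (substLast c : MvPolynomial (Fin 3) ℂ →+* MvPolynomial (Fin 3) ℂ)) =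
        eval (Function.update x 2 c) := by
      refine MvPolynomial.ringHom_ext (fun r => ?_) fun i => ?_
      · simp [substLast]
      · fin_cases i <;> simp [substLast]
    exact congrArg (fun f => f g) this
  rw [h1, eval_update_of_degreeOf_eq_zero hg]

/-- Eliminate z_i: the first polynomial is linear in z_i and the second quadratic, and g divides
their resultant, a nonzero polynomial in z_j alone. -/
lemma degreeOf_eq_zero_of_dvd {g : MvPolynomial (Fin 3) ℂ} {i j : Fin 3}
    (hij : (i, j) = (0, 1) ∨ (i, j) = (1, 0))
    (hC : g ∣ 3 - 2 * X i - 2 * X j + 3 * X i * X j)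
    (hD : g ∣ (3 - X i - X j) ^ 2 + X i * X j) : g.degreeOf i = 0 := by
  -- Obtained by substituting z_i = (3 - 2z_j)/(2 - 3z_j), the zero of the linear polynomial, into
  -- the quadratic one and clearing denominators.
  set r : MvPolynomial (Fin 3) ℂ := (3 - 2 * X j) ^ 2 +
    (3 * X j - 6) * (2 - 3 * X j) * (3 - 2 * X j) + (2 - 3 * X j) ^ 2 * (3 - X j) ^ 2 with hr
  have hdvd : g ∣ r := by
    have : r = (2 - 3 * X j) ^ 2 * ((3 - X i - X j) ^ 2 + X i * X j) +
        ((3 - 2 * X j) + (2 - 3 * X j) * X i + (3 * X j - 6) * (2 - 3 * X j)) *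
          (3 - 2 * X i - 2 * X j + 3 * X i * X j) := by
      rw [hr]; ring
    rw [this]
    exact dvd_add (Dvd.dvd.mul_left hD _) (Dvd.dvd.mul_left hC _)
  have hr0 : r ≠ 0 := by
    intro h
    have := congrArg (eval 0) h
    rw [hr] at this
    simp only [map_add, map_sub, map_mul, map_pow, eval_X, map_ofNat, map_zero] at this
    norm_num at this
  have hj : (X j : MvPolynomial (Fin 3) ℂ) ∈ supported ℂ ({i}ᶜ : Set (Fin 3)) := by
    refine X_mem_supported.2 ?_
    rcases hij with h | h <;> obtain ⟨rfl, rfl⟩ := Prod.mk.inj h <;> simp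
  have hrd : r.degreeOf i = 0 := by
    rw [hr]
    apply degreeOf_eq_zero_of_mem_supported
    with_reducible apply_rules [add_mem, sub_mem, pow_mem, mul_mem, ofNat_mem]
  have := degreeOf_le_of_dvd (i := i) hdvd hr0
  omega

/-- A common prime g divides the determinant, so it is free of z₃ and divides both z₃-coefficients D
and C of the denominator. These are isolated by setting z₃ = 0 and z₃ = 1; elimination then removes
z₁ and z₂ from g, making it a unit. -/
lemma isReducedForm_compPow_three :
    IsReducedForm (compPow (stdRIF 3) 2) (numPow 2 2) denomThreeTwo := by
  rw [← denPow_two_two]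
  refine ⟨isRationalForm_compPow 2 one_le_two, IsRelPrime.symm ?_⟩
  rw [UniqueFactorizationMonoid.isRelPrime_iff_no_prime_factors
    (isRationalForm_compPow 2 one_le_two).den_ne_zero]
  intro g hp hq hg
  have hdet : rename (R := ℂ) (Fin.castSucc : Fin 2 → Fin 3) (mobDet 2) ≠ 0 := by
    rw [Ne, map_eq_zero_iff _ (rename_injective _ (Fin.castSucc_injective 2))]
    intro h
    obtain ⟨v, hv, hv1⟩ := (frequently_mem_torus one_le_two).exists
    exact eval_mobDet_ne_zero hv hv1 (by rw [h, map_zero])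
  have hg2 : g.degreeOf 2 = 0 := by
    have h1 := degreeOf_le_of_dvd (i := 2) (dvd_rename_mobDet hg hq hp) hdet
    have h2 : degreeOf 2 (rename (R := ℂ) (Fin.castSucc : Fin 2 → Fin 3) (mobDet 2)) = 0 :=
      degreeOf_last_rename (mobDet 2)
    omega
  have hsub : ∀ c, g ∣ substLast c denomThreeTwo := fun c => by
    rw [denPow_two_two] at hp
    simpa only [substLast_eq_self hg2] using map_dvd (substLast c) hp
  have hval : ∀ c, substLast c denomThreeTwo = (3 - X 0 - X 1) ^ 2 + X 0 * X 1 -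
      C c * (3 - 2 * X 0 - 2 * X 1 + 3 * X 0 * X 1) := fun c => by
    simp only [denomThreeTwo, substLast, map_add, map_sub, map_mul, map_pow, aeval_X, map_ofNat]
    simp
    ring
  have hD : g ∣ (3 - X 0 - X 1) ^ 2 + X 0 * X 1 := by simpa [hval] using hsub 0
  have hC : g ∣ 3 - 2 * X 0 - 2 * X 1 + 3 * X 0 * X 1 := by
    have h1 := dvd_sub hD (hsub 1)
    rw [hval] at h1
    simpa using h1
  have hg0 := degreeOf_eq_zero_of_dvd (Or.inl rfl) hC hD
  have hg1 : g.degreeOf 1 = 0 := by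
    refine degreeOf_eq_zero_of_dvd (i := 1) (j := 0) (Or.inr rfl) ?_ ?_
    · convert hC using 1; ring
    · convert hD using 1; ring
  refine hg.not_isUnit (isUnit_of_forall_degreeOf_eq_zero hg.ne_zero fun i => ?_)
  fin_cases i
  · exact hg0
  · exact hg1
  · exact hg2

end threeVariables

/-- Here `d = n + 1 ≥ 2`, and `compPow (stdRIF d) N` is the `N`-th composition of `φ_d`. -/
theorem mainTheorem5 :
    (∀ n N : ℕ, 1 ≤ n → 1 ≤ N →
      IsRationalInner (compPow (stdRIF (n + 1)) N) ∧
      HasDegreeIn (compPow (stdRIF (n + 1)) N) (Fin.last n) 1 ∧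
      singularSet (compPow (stdRIF (n + 1)) N) = {1} ∧
      (∀ r : ℝ, 1 ≤ r →
        (BoundaryMemLp (lastDeriv (compPow (stdRIF (n + 1)) N)) r Set.univ ↔
          r < cutoff (n + 1) N)) ∧
      IsLocalDerivIndex (compPow (stdRIF (n + 1)) N) 1 (cutoff (n + 1) N)) ∧
    ((∃ q : MvPolynomial (Fin 3) ℂ, IsReducedForm (compPow (stdRIF 3) 2) q denomThreeTwo) ∧
      HasDegreeIn (compPow (stdRIF 3) 2) 0 2 ∧
      HasDegreeIn (compPow (stdRIF 3) 2) 1 2 ∧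
      HasDegreeIn (compPow (stdRIF 3) 2) 2 1 ∧
      singularSet (compPow (stdRIF 3) 2) = {1} ∧
      IsLocalDerivIndex (compPow (stdRIF 3) 2) 1 (3 / 2) ∧
      IsLocalDerivIndex (stdRIF 3) 1 2) ∧
    (∀ K : ℕ, 1 ≤ K →
      IsRationalInner (compPow (stdRIF 2) K) ∧
      singularSet (compPow (stdRIF 2) K) = {1} ∧
      HasContactOrder (compPow (stdRIF 2) K) 0 0 (2 * K)) := by
  refine ⟨fun n N hn hN => ⟨isRationalInner_compPow hn hN, hasDegreeIn_last_compPow hn hN,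
    singularSet_compPow hn hN, fun r hr => boundaryMemLp_univ_iff hn hN hr,
    isLocalDerivIndex_compPow hn hN⟩,
    ⟨⟨_, isReducedForm_compPow_three⟩,
      ⟨_, _, isReducedForm_compPow_three, max_degreeOf_two_two (Or.inl rfl)⟩,
      ⟨_, _, isReducedForm_compPow_three, max_degreeOf_two_two (Or.inr rfl)⟩,
      hasDegreeIn_last_compPow one_le_two one_le_two,
      singularSet_compPow one_le_two one_le_two, ?_, ?_⟩,
    fun K hK => ⟨isRationalInner_compPow le_rfl hK, singularSet_compPow le_rfl hK,
      hasContactOrder_compPow hK⟩⟩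
  · have h := isLocalDerivIndex_compPow one_le_two one_le_two
    have hc : cutoff (2 + 1) 2 = 3 / 2 := by norm_num [cutoff]
    rwa [hc] at h
  · have h := isLocalDerivIndex_compPow one_le_two (le_refl 1)
    have hc : cutoff (2 + 1) 1 = 2 := by norm_num [cutoff]
    have hone : compPow (stdRIF (2 + 1)) 1 = stdRIF 3 := by
      funext z
      simp [compPow]
    rwa [hc, hone] at h
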